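/- A \emph{disk} in a real vector space $V$ is a nonempty convex subset $D\subseteq V$ with $tD\subseteq D$ for all $t\in[-1,1]$; its span $V_D$ carries the gauge semi-norm $v\mapsto\inf\{r>0 : v\in rD\}$. A \emph{base of a complete convex bornology} on $V$ is a set $\mathcal B$ of disks such that $V=\bigcup\mathcal B$; $D,D'\in\mathcal B$ implies $D+D'\in\mathcal B$; $D\in\mathcal B$ and $r>0$ imply $rD\in\mathcal B$; and for every $D\in\mathcal B$ the semi-normed space $V_D$ is a Banach space. The \emph{bounded} sets are the subsets of members of $\mathcal B$, and two bases are identified if they have the same bounded sets. Let $\mathsf{CBorn}$ be the category of real vector spaces equipped with a complete convex bornology, with the linear maps sending bounded sets to bounded sets as morphisms. Every Banach space is an object of $\mathsf{CBorn}$, its closed balls about $0$ of positive radius forming a base. A strict epimorphism in $\mathsf{CBorn}$ is a morphism that is a coequalizer. For a cardinal $\kappa$ let $\mathsf{CBorn}_\kappa\subseteq\mathsf{CBorn}$ be the full subcategory of those $X$ for which there are a set $I$, cardinals $\kappa_i<\kappa$ ($i\in I$), and a strict epimorphism in $\mathsf{CBorn}$ from the direct sum $\bigoplus_{i\in I}\ell^1(\kappa_i)$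 to $X$. An object $P$ of a category is \emph{$\kappa$-presentable} if $\operatorname{Hom}(P,-)$ preserves $\kappa$-directed colimits. A category is \emph{locally $\kappa$-presentable} if it is cocomplete and has a set of $\kappa$-presentable objects such that every object is a $\kappa$-directed colimit of objects from this set. \textbf{Theorem.} Let $\kappa\ge\aleph_0$ be a regular cardinal. Then the category $\mathsf{CBorn}_\kappa$ is locally $\kappa$-presentable. Moreover, every Banach space having a dense subset of cardinality $<\kappa$ (that is, of density character $<\kappa$) is $\kappa$-presentable in $\mathsf{CBorn}$. -/

import Mathlib

open CategoryTheory CategoryTheory.Limits Cardinal Filter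
open scoped Topology Pointwise lp

universe u

/-! ### Complete convex bornologies -/

/-- A disk in a real vector space: a nonempty convex circled subset. -/
structure IsDisk {V : Type u} [AddCommGroup V] [Module ℝ V] (D : Set V) : Prop where
  nonempty : D.Nonempty
  convex : Convex ℝ D
  balanced : Balanced ℝ D

/-- The disk `D` is a Banach disk: its linear span, equipped with the gauge semi-norm
`v ↦ inf {r > 0 | v ∈ r • D}`, is a Banach space (the gauge separates points of the span, and every
sequence in the span that is Cauchy for the gauge converges for the gauge to a vector of the span). -/
structure IsBanachDisk {V : Type u} [AddCommGroup V] [Module ℝ V] (D : Set V) : Prop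
    extends IsDisk D where
  eq_zero_of_gauge : ∀ v ∈ Submodule.span ℝ D, gauge D v = 0 → v = 0
  complete : ∀ x : ℕ → V, (∀ n, x n ∈ Submodule.span ℝ D) →
    (∀ ε > 0, ∃ N, ∀ m ≥ N, ∀ n ≥ N, gauge D (x m - x n) < ε) →
    ∃ v ∈ Submodule.span ℝ D, Tendsto (fun n => gauge D (x n - v)) atTop (𝓝 0)

/-- A base of a complete convex bornology on a real vector space. -/
structure IsCompleteConvexBase {V : Type u} [AddCommGroup V] [Module ℝ V]
    (B : Set (Set V)) : Prop where
  banachDisk : ∀ D ∈ B, IsBanachDisk D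
  cover : ⋃₀ B = Set.univ
  add_mem : ∀ D ∈ B, ∀ D' ∈ B, D + D' ∈ B
  smul_mem : ∀ D ∈ B, ∀ r : ℝ, 0 < r → r • D ∈ B

/-- A bornology on a real vector space is complete and convex if its bounded sets are exactly the
subsets of the members of some base of a complete convex bornology. (Two bases are equivalent if and
only if they have the same bounded sets, so that an equivalence class of bases is the same thing as
the resulting collection of bounded sets.) -/
class IsCompleteConvexBornology (V : Type u) [AddCommGroup V] [Module ℝ V] [Bornology V] :
    Prop where
  exists_base : ∃ B : Set (Set V), IsCompleteConvexBase B ∧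
    ∀ s : Set V, Bornology.IsBounded s ↔ ∃ D ∈ B, s ⊆ D

/-! ### The category of complete convex bornological spaces -/

/-- Complete convex bornological spaces over `ℝ`. -/
structure CBorn : Type (u + 1) where
  carrier : Type u
  [addCommGroup : AddCommGroup carrier]
  [module : Module ℝ carrier]
  [bornology : Bornology carrier]
  [isComplete : IsCompleteConvexBornology carrier]

namespace CBorn

instance : CoeSort CBorn.{u} (Type u) := ⟨CBorn.carrier⟩

attribute [instance] addCommGroup module bornology isComplete

/-- Morphisms: linear maps that send bounded subsets to bounded subsets. -/
@[ext]
structure Hom (X Y : CBorn.{u}) : Type u where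
  toLinearMap : X →ₗ[ℝ] Y
  isBounded_image : ∀ s : Set X, Bornology.IsBounded s → Bornology.IsBounded (toLinearMap '' s)

instance : Category.{u} CBorn.{u} where
  Hom X Y := Hom X Y
  id X := ⟨LinearMap.id, fun s hs => by simpa using hs⟩
  comp f g := ⟨g.toLinearMap.comp f.toLinearMap, fun s hs => by
    simpa [Set.image_image] using g.isBounded_image _ (f.isBounded_image s hs)⟩

end CBorn

/-! ### Banach spaces as complete convex bornological spaces -/

theorem closedBall_zero_add_closedBall_zero {E : Type u} [NormedAddCommGroup E] [NormedSpace ℝ E]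
    {r s : ℝ} (hr : 0 < r) (hs : 0 < s) :
    Metric.closedBall (0 : E) r + Metric.closedBall (0 : E) s = Metric.closedBall 0 (r + s) := by
  apply Set.Subset.antisymm
  · rintro _ ⟨x, hx, y, hy, rfl⟩
    rw [mem_closedBall_zero_iff] at hx hy ⊢
    exact (norm_add_le x y).trans (add_le_add hx hy)
  · intro y hy
    rw [mem_closedBall_zero_iff] at hy
    have h : 0 < r + s := by positivity
    have key : ∀ t : ℝ, 0 < t → ‖(t / (r + s)) • y‖ ≤ t := fun t ht => by
      rw [norm_smul, Real.norm_of_nonneg (by positivity), div_mul_eq_mul_div, div_le_iff₀ h]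
      exact mul_le_mul_of_nonneg_left hy ht.le
    refine ⟨(r / (r + s)) • y, by simpa using key r hr, (s / (r + s)) • y,
      by simpa using key s hs, ?_⟩
    change (r / (r + s)) • y + (s / (r + s)) • y = y
    rw [← add_smul, ← add_div, div_self h.ne', one_smul]

theorem isBanachDisk_closedBall {E : Type u} [NormedAddCommGroup E] [NormedSpace ℝ E]
    [CompleteSpace E] {r : ℝ} (hr : 0 < r) : IsBanachDisk (Metric.closedBall (0 : E) r) where
  nonempty := ⟨0, by simpa using hr.le⟩
  convex := convex_closedBall 0 r
  balanced := balanced_closedBall_zero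
  eq_zero_of_gauge v _ hv := by
    rw [gauge_closedBall hr.le, div_eq_zero_iff] at hv
    exact norm_eq_zero.mp (hv.resolve_right hr.ne')
  complete x _ hx := by
    have hc : CauchySeq x := by
      rw [Metric.cauchySeq_iff]
      intro ε hε
      obtain ⟨N, hN⟩ := hx (ε / r) (by positivity)
      refine ⟨N, fun m hm n hn => ?_⟩
      have := hN m hm n hn
      rwa [gauge_closedBall hr.le, div_lt_div_iff_of_pos_right hr, ← dist_eq_norm] at this
    obtain ⟨v, hv⟩ := cauchySeq_tendsto_of_complete hc
    refine ⟨v, ?_, ?_⟩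
    · have hu : Submodule.span ℝ (Metric.closedBall (0 : E) r) = ⊤ := by
        rw [eq_top_iff]
        intro y _
        have hy : 0 < ‖y‖ + 1 := by positivity
        have h1 : (r / (‖y‖ + 1)) • y ∈ Metric.closedBall (0 : E) r := by
          rw [mem_closedBall_zero_iff, norm_smul, Real.norm_of_nonneg (by positivity),
            div_mul_eq_mul_div, div_le_iff₀ hy]
          exact mul_le_mul_of_nonneg_left (by linarith) hr.le
        have h2 := Submodule.smul_mem _ ((r / (‖y‖ + 1))⁻¹) (Submodule.subset_span (R := ℝ) h1)
        rwa [smul_smul, inv_mul_cancel₀ (by positivity), one_smul] at h2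
      rw [hu]
      trivial
    · simp only [gauge_closedBall hr.le]
      have := (tendsto_iff_norm_sub_tendsto_zero.mp hv).div_const r
      simpa using this

/-- The metric bornology of a Banach space is a complete convex bornology, with the closed balls
of positive radius about `0` as a base. -/
instance instIsCompleteConvexBornologyOfBanach (E : Type u) [NormedAddCommGroup E]
    [NormedSpace ℝ E] [CompleteSpace E] : IsCompleteConvexBornology E where
  exists_base := by
    refine ⟨{D | ∃ r : ℝ, 0 < r ∧ D = Metric.closedBall 0 r}, ⟨?_, ?_, ?_, ?_⟩, fun s => ?_⟩
    · rintro _ ⟨r, hr, rfl⟩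
      exact isBanachDisk_closedBall hr
    · refine Set.eq_univ_of_forall fun x => ⟨Metric.closedBall 0 (‖x‖ + 1),
        ⟨‖x‖ + 1, by positivity, rfl⟩, by simp⟩
    · rintro _ ⟨r, hr, rfl⟩ _ ⟨s, hs, rfl⟩
      exact ⟨r + s, by positivity, closedBall_zero_add_closedBall_zero hr hs⟩
    · rintro _ ⟨r, hr, rfl⟩ t ht
      refine ⟨t * r, by positivity, ?_⟩
      rw [smul_closedBall _ _ hr.le, smul_zero, Real.norm_of_nonneg ht.le]
    · constructor
      · intro h
        obtain ⟨r, hr, hs⟩ := h.subset_closedBall_lt 0 0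
        exact ⟨_, ⟨r, hr, rfl⟩, hs⟩
      · rintro ⟨_, ⟨r, _, rfl⟩, hs⟩
        exact Metric.isBounded_closedBall.subset hs

/-- The complete convex bornological space underlying a Banach space. -/
def CBorn.ofBanach (E : Type u) [NormedAddCommGroup E] [NormedSpace ℝ E] [CompleteSpace E] :
    CBorn.{u} := ⟨E⟩

/-- The Banach space `ℓ¹(S)` of absolutely summable real families indexed by `S`, as a complete
convex bornological space. -/
noncomputable def CBorn.ellOne (S : Type u) : CBorn.{u} :=
  CBorn.ofBanach (lp (fun _ : S => ℝ) 1)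

/-! ### Restriction of the size of the Banach pieces -/

/-- `X` is the target of a strict epimorphism (a coequalizer in the category of complete convex
bornological spaces) out of a direct sum (coproduct) of a small family of spaces `ℓ¹(S i)`, where
each `S i` has fewer than `κ` elements. -/
def CBorn.isQuotientOfSum (κ : Cardinal.{u}) : ObjectProperty CBorn.{u} := fun X =>
  ∃ (I : Type u) (S : I → Type u) (_ : ∀ i, #(S i) < κ)
    (c : Cofan fun i => CBorn.ellOne (S i)) (_ : IsColimit c) (f : c.pt ⟶ X), IsRegularEpi f

/-- The full subcategory of the complete convex bornological spaces that are quotients of direct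
sums of spaces `ℓ¹(κ')` with `κ' < κ`. -/
abbrev CBornLT (κ : Cardinal.{u}) := (CBorn.isQuotientOfSum κ).FullSubcategory

/-- The density character of a topological space: the smallest cardinality of a dense subset. -/
noncomputable def densityCharacter (E : Type u) [TopologicalSpace E] : Cardinal.{u} :=
  sInf {c | ∃ s : Set E, Dense s ∧ #s = c}

/-! ### Disks and their spans -/

/-! The space `ℓ¹(S)` represents bounded families: a morphism `ℓ¹(S) ⟶ X` is the same as a bounded
family `S → X` (`exists_ellOne_hom`, `ellOne_hom_ext`). Accordingly `X` lies in `CBornLT κ` iff each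
of its bounded sets lies in the image of the unit ball of some `ℓ¹(S)` with `#S < κ`
(`isQuotientOfSum_iff`). Refining the bornology of `X` to the one generated by these images gives a
coreflection, so this class is stable under colimits and strict quotients. As `CBorn` is cocomplete
(divide the vector space colimit by the vectors that every cocone kills), so is `CBornLT κ`.

The main point is that no such division is needed for the `κ`-filtered diagrams in question: the
vector space colimit is already separated. For `κ > ℵ₀` the countably many relations witnessing
non-separation hold at one stage, where they contradict separatedness; for `κ = ℵ₀` bounded sets are
finite-dimensional and a closed-subspace argument applies. Bounded sets of the colimit then come
from a single stage, and a vector that vanishes in the colimit vanishes at some stage. So a bounded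
family lifts to a stage, and two morphisms from `ℓ¹(S)` with `#S < κ` that agree in the colimit
agree on all unit vectors at a later stage: `ℓ¹(S)` is `κ`-presentable in `CBornLT κ`. These spaces
form a strong generator, which gives local presentability.

A Banach space `E` with a dense subset smaller than `κ` is, for `κ > ℵ₀`, a quotient of such an
`ℓ¹(S)` by a closed subspace that itself has a dense subset smaller than `κ`. Lift from `ℓ¹(S)` and
kill this subset at a later stage; closedness of kernels does the rest. For `κ = ℵ₀` the space `E`
is zero. -/

namespace IsDisk

variable {V : Type u} [AddCommGroup V] [Module ℝ V] {D : Set V}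

theorem zero_mem (hD : IsDisk D) : (0 : V) ∈ D := hD.balanced.zero_mem hD.nonempty

theorem smul_mono (hD : IsDisk D) {a b : ℝ} (ha : 0 ≤ a) (hab : a ≤ b) : a • D ⊆ b • D :=
  hD.balanced.smul_mono (by rwa [Real.norm_of_nonneg ha, Real.norm_of_nonneg (ha.trans hab)])

theorem exists_mem_smul (hD : IsDisk D) {v : V} (hv : v ∈ Submodule.span ℝ D) :
    ∃ r : ℝ, 0 < r ∧ v ∈ r • D := by
  induction hv using Submodule.span_induction with
  | mem x hx => exact ⟨1, one_pos, by simpa using hx⟩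
  | zero => exact ⟨1, one_pos, by simpa using hD.zero_mem⟩
  | add x y _ _ hx hy =>
    obtain ⟨r, hr, hx⟩ := hx
    obtain ⟨s, hs, hy⟩ := hy
    refine ⟨r + s, by positivity, ?_⟩
    rw [hD.convex.add_smul hr.le hs.le]
    exact Set.add_mem_add hx hy
  | smul c x _ hx =>
    obtain ⟨r, hr, y, hy, rfl⟩ := hx
    have hc : 0 < |c| + 1 := by positivity
    refine ⟨(|c| + 1) * r, by positivity, (c / (|c| + 1)) • y,
      hD.balanced.smul_mem (by
        rw [norm_div, Real.norm_of_nonneg hc.le, div_le_one hc, Real.norm_eq_abs]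
        linarith) hy, ?_⟩
    change ((|c| + 1) * r) • (c / (|c| + 1)) • y = c • r • y
    rw [smul_smul, smul_smul]
    congr 1
    field_simp

/-- The seminorm properties of a gauge require an absorbent set, and `D` is guaranteed to absorb
only the vectors of its own span. -/
theorem absorbent_preimage (hD : IsDisk D) :
    Absorbent ℝ ((↑) ⁻¹' D : Set (Submodule.span ℝ D)) := by
  rw [absorbent_iff_eventually_nhdsNE_zero]
  intro w
  obtain ⟨r, hr, y, hy, hw⟩ := hD.exists_mem_smul w.2
  have h : Tendsto (fun c : ℝ => ‖c‖ * r) (𝓝[≠] 0) (𝓝 0) := by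
    have : Continuous (fun c : ℝ => ‖c‖ * r) := by fun_prop
    simpa using (this.tendsto 0).mono_left nhdsWithin_le_nhds
  filter_upwards [h.eventually (Iic_mem_nhds one_pos)] with c hc
  change c • (w : V) ∈ D
  rw [← hw]
  change c • r • y ∈ D
  rw [smul_smul]
  exact hD.balanced.smul_mem (by
    rw [norm_mul, Real.norm_of_nonneg hr.le]
    exact hc) hy

/-- The gauge of a disk as a semi-norm on its span. -/
noncomputable def spanSeminorm (hD : IsDisk D) : Seminorm ℝ (Submodule.span ℝ D) :=
  gaugeSeminorm (s := (↑) ⁻¹' D)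
    (fun a ha => by
      rintro _ ⟨x, hx, rfl⟩
      exact hD.balanced.smul_mem ha hx)
    (hD.convex.linear_preimage (Submodule.span ℝ D).subtype) hD.absorbent_preimage

theorem spanSeminorm_apply (hD : IsDisk D) (w : Submodule.span ℝ D) :
    hD.spanSeminorm w = gauge D (w : V) := by
  change gauge _ w = _
  rw [gauge_def', gauge_def']
  rfl

theorem mem_smul_of_gauge_lt (hD : IsDisk D) {v : V} (hv : v ∈ Submodule.span ℝ D) {a : ℝ}
    (h : gauge D v < a) : v ∈ a • D := by
  rw [← hD.spanSeminorm_apply ⟨v, hv⟩] at h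
  obtain ⟨b, hb, hba, y, hy, hw⟩ := exists_lt_of_gauge_lt hD.absorbent_preimage h
  refine hD.smul_mono hb.le hba.le ⟨y, hy, ?_⟩
  exact congrArg Subtype.val hw

theorem gauge_add_le (hD : IsDisk D) {v w : V} (hv : v ∈ Submodule.span ℝ D)
    (hw : w ∈ Submodule.span ℝ D) : gauge D (v + w) ≤ gauge D v + gauge D w := by
  simpa [spanSeminorm_apply] using map_add_le_add hD.spanSeminorm ⟨v, hv⟩ ⟨w, hw⟩

end IsDisk

/-- A Banach disk is, up to a factor, the image of the unit ball of a Banach space. -/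
theorem IsBanachDisk.exists_banach {V : Type u} [AddCommGroup V] [Module ℝ V] {D : Set V}
    (hD : IsBanachDisk D) :
    ∃ (E : Type u) (_ : NormedAddCommGroup E) (_ : NormedSpace ℝ E) (_ : CompleteSpace E)
      (Φ : E →ₗ[ℝ] V), D ⊆ Φ '' Metric.closedBall 0 1 ∧
        Φ '' Metric.closedBall 0 1 ⊆ (2 : ℝ) • D := by
  let p := hD.toIsDisk.spanSeminorm
  have hp (w) : p w = gauge D (w : V) := hD.toIsDisk.spanSeminorm_apply w
  let : Norm (Submodule.span ℝ D) := ⟨p⟩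
  have core : NormedSpace.Core ℝ (Submodule.span ℝ D) :=
    { norm_nonneg := fun x => apply_nonneg p x
      norm_smul := fun c x => map_smul_eq_mul p c x
      norm_triangle := fun x y => map_add_le_add p x y
      norm_eq_zero_iff := fun x => ⟨fun h => Subtype.ext (hD.eq_zero_of_gauge x x.2
        ((hp x).symm.trans h)), fun h => by rw [h]; exact map_zero p⟩ }
  let : NormedAddCommGroup (Submodule.span ℝ D) := NormedAddCommGroup.ofCore core
  let : NormedSpace ℝ (Submodule.span ℝ D) := NormedSpace.ofCore core
  have hn (w : Submodule.span ℝ D) : ‖w‖ = gauge D (w : V) := hp w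
  refine ⟨Submodule.span ℝ D, inferInstance, inferInstance, ?_, (Submodule.span ℝ D).subtype,
    ?_, ?_⟩
  · refine Metric.complete_of_cauchySeq_tendsto fun x hx => ?_
    obtain ⟨v, hv, hlim⟩ := hD.complete (fun n => x n) (fun n => (x n).2) (fun ε hε => by
      obtain ⟨N, hN⟩ := Metric.cauchySeq_iff.mp hx ε hε
      exact ⟨N, fun m hm n hn' => by simpa [dist_eq_norm, hn] using hN m hm n hn'⟩)
    refine ⟨⟨v, hv⟩, ?_⟩
    rw [tendsto_iff_norm_sub_tendsto_zero]
    simpa [hn] using hlim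
  · intro d hd
    refine ⟨⟨d, Submodule.subset_span hd⟩, ?_, rfl⟩
    rw [mem_closedBall_zero_iff, hn]
    exact gauge_le_one_of_mem hd
  · rintro _ ⟨w, hw, rfl⟩
    rw [mem_closedBall_zero_iff, hn] at hw
    -- A vector of gauge 1 may lie outside `D`, but it lies in `a • D` for every `a > 1`; hence the
    -- factor 2.
    exact hD.mem_smul_of_gauge_lt w.2 (by linarith)

/-! ### Images of unit balls of Banach spaces -/

section Image

variable {V : Type u} [AddCommGroup V] [Module ℝ V] {E : Type*} [NormedAddCommGroup E]
  [NormedSpace ℝ E]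

theorem isDisk_image_closedBall (Φ : E →ₗ[ℝ] V) : IsDisk (Φ '' Metric.closedBall 0 1) where
  nonempty := ⟨0, 0, by simp, by simp⟩
  convex := (convex_closedBall 0 1).linear_image Φ
  balanced a ha := by
    rintro _ ⟨_, ⟨e, he, rfl⟩, rfl⟩
    exact ⟨a • e, balanced_closedBall_zero.smul_mem ha he, by simp⟩

theorem apply_mem_smul_image_closedBall (Φ : E →ₗ[ℝ] V) (e : E) {r : ℝ} (hr : 0 < r)
    (he : ‖e‖ ≤ r) : Φ e ∈ r • Φ '' Metric.closedBall 0 1 := by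
  refine ⟨Φ (r⁻¹ • e), ⟨r⁻¹ • e, ?_, rfl⟩, ?_⟩
  · rw [mem_closedBall_zero_iff, norm_smul, norm_inv, Real.norm_of_nonneg hr.le]
    exact inv_mul_le_one_of_le₀ he hr.le
  · change r • Φ (r⁻¹ • e) = Φ e
    rw [map_smul, smul_inv_smul₀ hr.ne']

theorem mem_span_image_closedBall (Φ : E →ₗ[ℝ] V) (e : E) :
    Φ e ∈ Submodule.span ℝ (Φ '' Metric.closedBall 0 1) := by
  obtain ⟨v, hv, h⟩ := apply_mem_smul_image_closedBall Φ e (r := ‖e‖ + 1) (by positivity)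
    (by linarith)
  rw [← h]
  exact Submodule.smul_mem _ _ (Submodule.subset_span hv)

theorem gauge_image_closedBall_le (Φ : E →ₗ[ℝ] V) (e : E) :
    gauge (Φ '' Metric.closedBall 0 1) (Φ e) ≤ ‖e‖ :=
  le_of_forall_pos_le_add fun ε hε => gauge_le_of_mem (by positivity)
    (apply_mem_smul_image_closedBall Φ e (by positivity) (by linarith))

/-- The image of the unit ball of a Banach space is a Banach disk as soon as its multiples
`n⁻¹ • Φ '' ball` intersect in `0`. -/
theorem isBanachDisk_image_closedBall [CompleteSpace E] (Φ : E →ₗ[ℝ] V)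
    (hsep : ∀ v, (∀ n : ℕ, (n : ℝ) • v ∈ Φ '' Metric.closedBall 0 1) → v = 0) :
    IsBanachDisk (Φ '' Metric.closedBall 0 1) := by
  have hD := isDisk_image_closedBall Φ
  set D := Φ '' Metric.closedBall 0 1 with hDdef
  refine { toIsDisk := hD, eq_zero_of_gauge := ?_, complete := ?_ }
  · intro v hv h0
    refine hsep v fun n => ?_
    obtain rfl | hn := Nat.eq_zero_or_pos n
    · simpa using hD.zero_mem
    have hn' : (0 : ℝ) < n := by exact_mod_cast hn
    obtain ⟨y, hy, h⟩ := hD.mem_smul_of_gauge_lt hv (a := (n : ℝ)⁻¹) (by rw [h0]; positivity)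
    rw [← h]
    change (n : ℝ) • (n : ℝ)⁻¹ • y ∈ D
    rwa [smul_inv_smul₀ hn'.ne']
  · intro x hx hc
    -- As for quotients of Banach spaces: along a subsequence whose steps lie in `2⁻ᵏ • D`, the
    -- differences lift to an absolutely convergent series in `E`, and the image of its sum gives
    -- the limit.
    have hc' (k : ℕ) := hc ((1 / 2) ^ k) (by positivity)
    choose N hN using hc'
    -- Partial sums of `N` dominate `N` and are monotone.
    let M (k : ℕ) : ℕ := ∑ i ∈ Finset.range (k + 1), N i
    have hMN (k) : N k ≤ M k :=
      Finset.single_le_sum (f := N) (fun _ _ => Nat.zero_le _) (by simp)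
    have hMs (k) : M k ≤ M (k + 1) := by
      simp only [M]
      rw [Finset.sum_range_succ _ (k + 1)]
      exact Nat.le_add_right _ _
    have hlt (k) : x (M (k + 1)) - x (M k) ∈ ((1 / 2 : ℝ) ^ k) • D :=
      hD.mem_smul_of_gauge_lt (Submodule.sub_mem _ (hx _) (hx _))
        (hN k _ ((hMN k).trans (hMs k)) _ (hMN k))
    have hex (k) : ∃ e : E, ‖e‖ ≤ (1 / 2 : ℝ) ^ k ∧ Φ e = x (M (k + 1)) - x (M k) := by
      obtain ⟨_, ⟨e, he, rfl⟩, h⟩ := hlt k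
      refine ⟨((1 / 2 : ℝ) ^ k) • e, ?_, by rw [map_smul]; exact h⟩
      rw [mem_closedBall_zero_iff] at he
      rw [norm_smul, Real.norm_of_nonneg (by positivity)]
      exact mul_le_of_le_one_right (by positivity) he
    choose e he hΦ using hex
    have hs : Summable e := Summable.of_norm_bounded summable_geometric_two he
    have hpart (k) : Φ (∑ i ∈ Finset.range k, e i) = x (M k) - x (M 0) := by
      rw [map_sum, ← Finset.sum_range_sub (fun k => x (M k))]
      exact Finset.sum_congr rfl fun i _ => hΦ i
    have hv : x (M 0) + Φ (∑' i, e i) ∈ Submodule.span ℝ D :=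
      Submodule.add_mem _ (hx _) (mem_span_image_closedBall _ _)
    refine ⟨x (M 0) + Φ (∑' i, e i), hv, ?_⟩
    have htail (k) : x (M k) - (x (M 0) + Φ (∑' i, e i)) =
        Φ ((∑ i ∈ Finset.range k, e i) - ∑' i, e i) := by
      rw [map_sub, hpart]
      abel
    have hlim : Tendsto (fun k => (1 / 2 : ℝ) ^ k + ‖(∑ i ∈ Finset.range k, e i) - ∑' i, e i‖)
        atTop (𝓝 (0 + 0)) :=
      (tendsto_pow_atTop_nhds_zero_of_lt_one (by norm_num) (by norm_num)).add
        (tendsto_iff_norm_sub_tendsto_zero.mp hs.hasSum.tendsto_sum_nat)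
    rw [add_zero] at hlim
    rw [Metric.tendsto_atTop]
    intro ε hε
    obtain ⟨k, hk⟩ := (hlim.eventually (Iio_mem_nhds hε)).exists
    refine ⟨N k, fun n hn => ?_⟩
    rw [Real.dist_eq, sub_zero, abs_of_nonneg (gauge_nonneg _)]
    have h1 := hD.gauge_add_le (Submodule.sub_mem _ (hx n) (hx (M k)))
      (Submodule.sub_mem _ (hx (M k)) hv)
    rw [sub_add_sub_cancel] at h1
    have h2 := hN k n hn (M k) (hMN k)
    have h3 : gauge D (x (M k) - (x (M 0) + Φ (∑' i, e i))) ≤ _ :=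
      (htail k).symm ▸ gauge_image_closedBall_le Φ _
    exact h1.trans_lt ((add_le_add h2.le h3).trans_lt hk)

end Image

/-! ### Bounded sets and their recognition -/

namespace IsCompleteConvexBornology

variable {V : Type u} [AddCommGroup V] [Module ℝ V] [Bornology V] [IsCompleteConvexBornology V]

theorem isBounded_add {s t : Set V} (hs : Bornology.IsBounded s) (ht : Bornology.IsBounded t) :
    Bornology.IsBounded (s + t) := by
  obtain ⟨B, hB, h⟩ := exists_base (V := V)
  obtain ⟨D, hD, hsD⟩ := (h s).mp hs
  obtain ⟨D', hD', htD⟩ := (h t).mp ht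
  exact (h _).mpr ⟨_, hB.add_mem D hD D' hD', Set.add_subset_add hsD htD⟩

theorem isBounded_smul {s : Set V} (hs : Bornology.IsBounded s) (r : ℝ) :
    Bornology.IsBounded (r • s) := by
  obtain ⟨B, hB, h⟩ := exists_base (V := V)
  obtain ⟨D, hD, hsD⟩ := (h s).mp hs
  refine (h _).mpr ⟨_, hB.smul_mem D hD (|r| + 1) (by positivity), ?_⟩
  refine (Set.smul_set_mono hsD).trans ((hB.banachDisk D hD).balanced.smul_mono ?_)
  rw [Real.norm_eq_abs, Real.norm_of_nonneg (by positivity)]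
  linarith

/-- A disk containing `(n + 1) • v` has gauge at most `1 / (n + 1)` at `v`. Separatedness is used
below in this form, which mentions neither gauges nor spans. -/
theorem eq_zero_of_isBounded {s : Set V} (hs : Bornology.IsBounded s) {v : V}
    (hv : ∀ n : ℕ, (n : ℝ) • v ∈ s) : v = 0 := by
  obtain ⟨B, hB, h⟩ := exists_base (V := V)
  obtain ⟨D, hD, hsD⟩ := (h s).mp hs
  refine (hB.banachDisk D hD).eq_zero_of_gauge v
    (Submodule.subset_span (by simpa using hsD (hv 1))) ?_
  refine le_antisymm (le_of_forall_pos_le_add fun ε hε => ?_) (gauge_nonneg _)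
  obtain ⟨n, hn⟩ := exists_nat_one_div_lt hε
  rw [zero_add]
  refine (gauge_le_of_mem (a := 1 / ((n : ℝ) + 1)) (by positivity) ?_).trans hn.le
  refine ⟨_, hsD (hv (n + 1)), ?_⟩
  change (1 / ((n : ℝ) + 1)) • ((n + 1 : ℕ) : ℝ) • v = v
  rw [smul_smul]
  push_cast
  rw [one_div_mul_cancel (by positivity), one_smul]

theorem exists_banach {s : Set V} (hs : Bornology.IsBounded s) :
    ∃ (E : Type u) (_ : NormedAddCommGroup E) (_ : NormedSpace ℝ E) (_ : CompleteSpace E)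
      (Φ : E →ₗ[ℝ] V), s ⊆ Φ '' Metric.closedBall 0 1 ∧
        Bornology.IsBounded (Φ '' Metric.closedBall 0 1) := by
  obtain ⟨B, hB, h⟩ := exists_base (V := V)
  obtain ⟨D, hD, hsD⟩ := (h s).mp hs
  obtain ⟨E, _, _, _, Φ, h1, h2⟩ := (hB.banachDisk D hD).exists_banach
  exact ⟨E, inferInstance, inferInstance, inferInstance, Φ, hsD.trans h1,
    (h _).mpr ⟨_, hB.smul_mem D hD 2 two_pos, h2⟩⟩

end IsCompleteConvexBornology

/-- A collection of subsets of a real vector space that is the collection of bounded sets of a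
complete convex bornology. -/
structure IsBoundedSystem {V : Type u} [AddCommGroup V] [Module ℝ V] (B : Set (Set V)) :
    Prop where
  mono : ∀ s ∈ B, ∀ t ⊆ s, t ∈ B
  singleton : ∀ v, {v} ∈ B
  add : ∀ s ∈ B, ∀ t ∈ B, s + t ∈ B
  smul : ∀ s ∈ B, ∀ r : ℝ, r • s ∈ B
  sep : ∀ s ∈ B, ∀ v, (∀ n : ℕ, (n : ℝ) • v ∈ s) → v = 0
  exists_banach : ∀ s ∈ B,
    ∃ (E : Type u) (_ : NormedAddCommGroup E) (_ : NormedSpace ℝ E) (_ : CompleteSpace E)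
      (Φ : E →ₗ[ℝ] V), s ⊆ Φ '' Metric.closedBall 0 1 ∧ Φ '' Metric.closedBall 0 1 ∈ B

namespace IsBoundedSystem

variable {V : Type u} [AddCommGroup V] [Module ℝ V] {B : Set (Set V)}

/-- The bornology whose bounded sets are the members of a bounded system. -/
@[reducible]
def toBornology (hB : IsBoundedSystem B) : Bornology V :=
  Bornology.ofBounded B
    (hB.mono _ (hB.singleton 0) _ (Set.empty_subset _)) hB.mono
    (fun s hs t ht => by
      obtain ⟨E, _, _, _, Φ, h1, h2⟩ := hB.exists_banach s hs
      obtain ⟨F, _, _, _, Ψ, h3, h4⟩ := hB.exists_banach t ht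
      refine hB.mono _ (hB.add _ h2 _ h4) _ (Set.union_subset (fun x hx => ?_) fun x hx => ?_)
      · exact ⟨x, h1 hx, 0, (isDisk_image_closedBall Ψ).zero_mem, add_zero x⟩
      · exact ⟨0, (isDisk_image_closedBall Φ).zero_mem, x, h3 hx, zero_add x⟩)
    hB.singleton

theorem isBounded_iff (hB : IsBoundedSystem B) (s : Set V) :
    @Bornology.IsBounded V hB.toBornology s ↔ s ∈ B :=
  @Bornology.isBounded_ofBounded_iff V s B _ _ _ _

/-- The members that are images of Banach unit balls form a base: `sep` makes such an image a Banach
disk, and the unit ball of `E × F` for the sup norm is the product of the unit balls, so a sum of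
images is again an image. -/
theorem isCompleteConvexBornology (hB : IsBoundedSystem B) :
    @IsCompleteConvexBornology V _ _ hB.toBornology := by
  let := hB.toBornology
  refine ⟨{D | D ∈ B ∧ ∃ (E : Type u) (_ : NormedAddCommGroup E) (_ : NormedSpace ℝ E)
    (_ : CompleteSpace E) (Φ : E →ₗ[ℝ] V), D = Φ '' Metric.closedBall 0 1},
    ⟨?_, ?_, ?_, ?_⟩, fun s => ?_⟩
  · rintro _ ⟨hD, E, _, _, _, Φ, rfl⟩
    exact isBanachDisk_image_closedBall Φ (hB.sep _ hD)
  · refine Set.eq_univ_of_forall fun v => ?_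
    obtain ⟨E, _, _, _, Φ, h1, h2⟩ := hB.exists_banach _ (hB.singleton v)
    exact ⟨_, ⟨h2, E, _, _, ‹_›, Φ, rfl⟩, h1 rfl⟩
  · rintro _ ⟨hD, E, _, _, _, Φ, rfl⟩ _ ⟨hD', F, _, _, _, Ψ, rfl⟩
    refine ⟨hB.add _ hD _ hD', E × F, inferInstance, inferInstance, inferInstance,
      Φ.coprod Ψ, ?_⟩
    ext v
    constructor
    · rintro ⟨_, ⟨e, he, rfl⟩, _, ⟨f, hf, rfl⟩, rfl⟩
      rw [mem_closedBall_zero_iff] at he hf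
      exact ⟨(e, f), by simpa using ⟨he, hf⟩, by simp⟩
    · rintro ⟨⟨e, f⟩, h, rfl⟩
      rw [mem_closedBall_zero_iff, Prod.norm_mk, sup_le_iff] at h
      exact ⟨Φ e, ⟨e, by simpa using h.1, rfl⟩, Ψ f, ⟨f, by simpa using h.2, rfl⟩, by simp⟩
  · rintro _ ⟨hD, E, _, _, _, Φ, rfl⟩ r hr
    refine ⟨hB.smul _ hD r, E, inferInstance, inferInstance, ‹_›, r • Φ, ?_⟩
    ext v
    simp [Set.mem_smul_set]
  · rw [hB.isBounded_iff]
    constructor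
    · intro hs
      obtain ⟨E, _, _, _, Φ, h1, h2⟩ := hB.exists_banach s hs
      exact ⟨_, ⟨h2, E, _, _, ‹_›, Φ, rfl⟩, h1⟩
    · rintro ⟨D, ⟨hD, -⟩, hs⟩
      exact hB.mono _ hD _ hs

/-- The complete convex bornological space defined by a bounded system. -/
@[reducible]
def toCBorn (hB : IsBoundedSystem B) : CBorn.{u} :=
  letI := hB.toBornology
  haveI := hB.isCompleteConvexBornology
  ⟨V⟩

end IsBoundedSystem

/-! ### Morphisms -/

namespace CBorn

variable {X Y Z : CBorn.{u}}

/-- The linear map underlying a morphism. -/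
def lin (f : X ⟶ Y) : X →ₗ[ℝ] Y := Hom.toLinearMap f

theorem isBounded_image_lin (f : X ⟶ Y) {s : Set X} (hs : Bornology.IsBounded s) :
    Bornology.IsBounded (lin f '' s) :=
  Hom.isBounded_image f s hs

/-- A linear map that preserves bounded sets, as a morphism. -/
def homMk (Φ : X →ₗ[ℝ] Y) (h : ∀ s : Set X, Bornology.IsBounded s → Bornology.IsBounded (Φ '' s)) :
    X ⟶ Y :=
  Hom.mk Φ h

@[simp]
theorem lin_comp (f : X ⟶ Y) (g : Y ⟶ Z) : lin (f ≫ g) = (lin g).comp (lin f) := rfl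

theorem lin_injective {f g : X ⟶ Y} (h : lin f = lin g) : f = g := Hom.ext h

theorem hom_ext {f g : X ⟶ Y} (h : ∀ x, lin f x = lin g x) : f = g :=
  lin_injective (LinearMap.ext h)

theorem lin_congr {f g : X ⟶ Y} (h : f = g) (x : X) : lin f x = lin g x := by rw [h]

theorem isIso_of_lin_bijective (f : X ⟶ Y) (h : Function.Bijective (lin f))
    (hb : ∀ t : Set Y, Bornology.IsBounded t →
      ∃ s : Set X, Bornology.IsBounded s ∧ t ⊆ lin f '' s) : IsIso f := by
  let e := LinearEquiv.ofBijective (lin f) h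
  refine ⟨homMk e.symm.toLinearMap fun t ht => ?_, hom_ext fun x => e.symm_apply_apply x,
    hom_ext fun y => e.apply_symm_apply y⟩
  obtain ⟨s, hs, hts⟩ := hb t ht
  refine hs.subset ?_
  rintro _ ⟨y, hy, rfl⟩
  obtain ⟨x, hx, rfl⟩ := hts hy
  change e.symm (e x) ∈ s
  rwa [e.symm_apply_apply]

open Classical in
/-- The unit vectors of `ℓ¹(S)`. -/
noncomputable def unitVec {S : Type u} (s : S) : ℓ^1(S, ℝ) := lp.single 1 s 1

/-- Passes from the classical decidability instance inside `unitVec` to an arbitrary one. -/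
theorem single_eq_unitVec {S : Type u} [DecidableEq S] (s : S) :
    lp.single (E := fun _ : S => ℝ) 1 s 1 = unitVec s := by
  unfold unitVec
  congr
  exact Subsingleton.elim _ _

theorem single_eq_smul_unitVec {S : Type u} [DecidableEq S] (s : S) (r : ℝ) :
    lp.single (E := fun _ : S => ℝ) 1 s r = r • unitVec s := by
  rw [← single_eq_unitVec, ← lp.single_smul, smul_eq_mul, mul_one]

/-! ### Bounded linear maps out of Banach spaces -/

section Banach

variable {E : Type u} [NormedAddCommGroup E] [NormedSpace ℝ E]

theorem isBounded_image_of_closedBall (Φ : E →ₗ[ℝ] X)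
    (h : Bornology.IsBounded (Φ '' Metric.closedBall 0 1)) {s : Set E}
    (hs : Bornology.IsBounded s) : Bornology.IsBounded (Φ '' s) := by
  obtain ⟨r, hr, hsr⟩ := hs.subset_closedBall_lt 0 0
  refine (IsCompleteConvexBornology.isBounded_smul h r).subset ?_
  rintro _ ⟨e, he, rfl⟩
  exact apply_mem_smul_image_closedBall Φ e hr (by simpa using hsr he)

/-- No topology on `X` is needed: if `k` in the kernel is within `1 / (n + 1)` of `e`, then `n • Φ e
= Φ (n • (e - k))` lies in the bounded image of the unit ball. This holds for all `n`, so `Φ e = 0`.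
-/
theorem isClosed_ker_of_isBounded (Φ : E →ₗ[ℝ] X)
    (h : Bornology.IsBounded (Φ '' Metric.closedBall 0 1)) :
    IsClosed (LinearMap.ker Φ : Set E) := by
  refine isClosed_of_closure_subset fun e he => ?_
  refine IsCompleteConvexBornology.eq_zero_of_isBounded h fun n => ?_
  obtain ⟨k, hk, hd⟩ := Metric.mem_closure_iff.mp he (1 / ((n : ℝ) + 1)) (by positivity)
  refine ⟨(n : ℝ) • (e - k), ?_, ?_⟩
  · rw [dist_eq_norm, lt_div_iff₀ (by positivity)] at hd
    rw [mem_closedBall_zero_iff, norm_smul, Real.norm_natCast]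
    nlinarith [norm_nonneg (e - k)]
  · rw [map_smul, map_sub, show Φ k = 0 from hk, sub_zero]

variable [CompleteSpace E]

/-- A linear map out of a Banach space that is bounded on the unit ball, as a morphism. -/
def ofBanachHom (Φ : E →ₗ[ℝ] X) (h : Bornology.IsBounded (Φ '' Metric.closedBall 0 1)) :
    ofBanach E ⟶ X :=
  homMk (X := ofBanach E) Φ fun _ hs => isBounded_image_of_closedBall Φ h hs

/-- The linear map underlying a morphism out of a Banach space. -/
def banachLin (f : ofBanach E ⟶ X) : E →ₗ[ℝ] X := lin f

theorem isBounded_image_banachLin (f : ofBanach E ⟶ X) {s : Set E}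
    (hs : Bornology.IsBounded s) : Bornology.IsBounded (banachLin f '' s) :=
  isBounded_image_lin f hs

theorem isClosed_ker_banachLin (f : ofBanach E ⟶ X) :
    IsClosed (LinearMap.ker (banachLin f) : Set E) :=
  isClosed_ker_of_isBounded _ (isBounded_image_banachLin f Metric.isBounded_closedBall)

theorem isBounded_image_sub (f g : ofBanach E ⟶ X) :
    Bornology.IsBounded ((banachLin f - banachLin g) '' Metric.closedBall 0 1) := by
  have hb (h : ofBanach E ⟶ X) : Bornology.IsBounded (banachLin h '' Metric.closedBall 0 1) :=
    isBounded_image_banachLin h Metric.isBounded_closedBall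
  refine (IsCompleteConvexBornology.isBounded_add (hb f)
    (IsCompleteConvexBornology.isBounded_smul (hb g) (-1))).subset ?_
  rintro _ ⟨e, he, rfl⟩
  exact ⟨banachLin f e, ⟨e, he, rfl⟩, -banachLin g e,
    ⟨banachLin g e, ⟨e, he, rfl⟩, neg_one_smul ℝ _⟩, (sub_eq_add_neg _ _).symm⟩

theorem banachLin_eq_of_mem_closure {f g : ofBanach E ⟶ X} {T : Set E}
    (h : ∀ e ∈ T, banachLin f e = banachLin g e) {e : E}
    (he : e ∈ closure (Submodule.span ℝ T : Set E)) : banachLin f e = banachLin g e :=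
  sub_eq_zero.mp (closure_minimal
    (t := (LinearMap.ker (banachLin f - banachLin g) : Set E))
    (Submodule.span_le.mpr fun e he => sub_eq_zero.mpr (h e he))
    (isClosed_ker_of_isBounded _ (isBounded_image_sub f g)) he)

theorem exists_ellOne_continuousLinearMap {S : Type u} (y : S → E) (hy : ∀ s, ‖y s‖ ≤ 1) :
    ∃ Φ : ℓ^1(S, ℝ) →L[ℝ] E, ‖Φ‖ ≤ 1 ∧ ∀ s, Φ (unitVec s) = y s := by
  classical
  have hsum (a : ℓ^1(S, ℝ)) : HasSum (fun s => ‖a s‖) ‖a‖ := by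
    simpa using lp.hasSum_norm (p := 1) (by simp) a
  have hle (a : ℓ^1(S, ℝ)) (s : S) : ‖a s • y s‖ ≤ ‖a s‖ := by
    rw [norm_smul]
    exact mul_le_of_le_one_right (norm_nonneg _) (hy s)
  have hs (a : ℓ^1(S, ℝ)) : Summable fun s => a s • y s :=
    Summable.of_norm_bounded (hsum a).summable (hle a)
  let Φ : ℓ^1(S, ℝ) →ₗ[ℝ] E :=
    { toFun := fun a => ∑' s, a s • y s
      map_add' := fun a b => by
        rw [← (hs a).tsum_add (hs b)]
        exact tsum_congr fun s => by rw [lp.coeFn_add, Pi.add_apply, add_smul]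
      map_smul' := fun c a => by
        rw [RingHom.id_apply, ← (hs a).tsum_const_smul]
        exact tsum_congr fun s => by rw [lp.coeFn_smul, Pi.smul_apply, smul_assoc] }
  refine ⟨Φ.mkContinuous 1 fun a => ?_, LinearMap.mkContinuous_norm_le _ zero_le_one _,
    fun s => ?_⟩
  · rw [one_mul]
    exact tsum_of_norm_bounded (hsum a) (hle a)
  · rw [← single_eq_unitVec]
    change ∑' t, (lp.single (E := fun _ : S => ℝ) 1 s 1) t • y t = y s
    rw [tsum_eq_single s fun t ht => by rw [lp.single_apply_ne _ _ _ ht, zero_smul],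
      lp.single_apply_self, one_smul]

end Banach

theorem norm_unitVec {S : Type u} (s : S) : ‖unitVec s‖ = 1 := by
  classical
  rw [← single_eq_unitVec, lp.norm_single one_pos, norm_one]

theorem mem_closure_span_range_unitVec {S : Type u} (a : ℓ^1(S, ℝ)) :
    a ∈ closure (Submodule.span ℝ (Set.range (unitVec (S := S))) : Set ℓ^1(S, ℝ)) := by
  classical
  refine mem_closure_of_tendsto (lp.hasSum_single ENNReal.one_ne_top a)
    (Eventually.of_forall fun t => Submodule.sum_mem _ fun s _ => ?_)
  rw [single_eq_smul_unitVec]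
  exact Submodule.smul_mem _ _ (Submodule.subset_span ⟨s, rfl⟩)

/-- The linear map underlying a morphism out of `ℓ¹(S)`. -/
noncomputable def ellLin {S : Type u} (f : ellOne S ⟶ X) : ℓ^1(S, ℝ) →ₗ[ℝ] X := lin f

@[simp]
theorem ellLin_comp {S : Type u} (f : ellOne S ⟶ X) (g : X ⟶ Y) (a : ℓ^1(S, ℝ)) :
    ellLin (f ≫ g) a = lin g (ellLin f a) := rfl

theorem isBounded_image_ellLin {S : Type u} (f : ellOne S ⟶ X) {s : Set ℓ^1(S, ℝ)}
    (hs : Bornology.IsBounded s) : Bornology.IsBounded (ellLin f '' s) :=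
  isBounded_image_lin f hs

theorem ellOne_hom_ext {S : Type u} {f g : ellOne S ⟶ X}
    (h : ∀ s, ellLin f (unitVec s) = ellLin g (unitVec s)) : f = g := by
  refine hom_ext fun a => banachLin_eq_of_mem_closure (T := Set.range unitVec) ?_
    (mem_closure_span_range_unitVec a)
  rintro _ ⟨s, rfl⟩
  exact h s

/-- The universal property of `ℓ¹(S)`: a bounded family extends to a morphism. -/
theorem exists_ellOne_hom {S : Type u} (x : S → X) (hx : Bornology.IsBounded (Set.range x)) :
    ∃ f : ellOne S ⟶ X, ∀ s, ellLin f (unitVec s) = x s := by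
  obtain ⟨E, _, _, _, Φ, h1, h2⟩ := IsCompleteConvexBornology.exists_banach hx
  choose y hy hyx using fun s => h1 ⟨s, rfl⟩
  obtain ⟨Ψ, hΨ, hs⟩ := exists_ellOne_continuousLinearMap y fun s => by simpa using hy s
  refine ⟨ofBanachHom (Φ.comp Ψ.toLinearMap) (h2.subset ?_), fun s => ?_⟩
  · rintro _ ⟨a, ha, rfl⟩
    rw [mem_closedBall_zero_iff] at ha
    refine ⟨Ψ a, ?_, rfl⟩
    rw [mem_closedBall_zero_iff]
    exact (Ψ.le_of_opNorm_le hΨ a).trans (by simpa using ha)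
  · exact (congrArg Φ (hs s)).trans (hyx s)

/-- The morphism out of `ℓ¹(S)` defined by a bounded family. -/
noncomputable def ellOneDesc {S : Type u} (x : S → X) (hx : Bornology.IsBounded (Set.range x)) :
    ellOne S ⟶ X :=
  (exists_ellOne_hom x hx).choose

@[simp]
theorem ellOneDesc_unitVec {S : Type u} (x : S → X) (hx : Bornology.IsBounded (Set.range x))
    (s : S) : ellLin (ellOneDesc x hx) (unitVec s) = x s :=
  (exists_ellOne_hom x hx).choose_spec s

/-- The image of the unit ball under a morphism out of `ℓ¹(S)`. -/
def ballImage {S : Type u} (f : ellOne S ⟶ X) : Set X := ellLin f '' Metric.closedBall 0 1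

theorem isBounded_ballImage {S : Type u} (f : ellOne S ⟶ X) :
    Bornology.IsBounded (ballImage f) :=
  isBounded_image_ellLin f Metric.isBounded_closedBall

theorem apply_unitVec_mem_ballImage {S : Type u} (f : ellOne S ⟶ X) (s : S) :
    ellLin f (unitVec s) ∈ ballImage f :=
  ⟨unitVec s, by simp [norm_unitVec], rfl⟩

theorem isBounded_range_unitVec {S : Type u} (f : ellOne S ⟶ X) :
    Bornology.IsBounded (Set.range fun s => ellLin f (unitVec s)) :=
  (isBounded_ballImage f).subset (by
    rintro _ ⟨s, rfl⟩
    exact apply_unitVec_mem_ballImage f s)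

theorem ballImage_comp {S : Type u} (f : ellOne S ⟶ X) (g : X ⟶ Y) :
    ballImage (f ≫ g) = lin g '' ballImage f := by
  rw [ballImage, ballImage, Set.image_image]
  rfl

/-- The morphism from `ℓ¹` of a point defined by a vector. -/
noncomputable def pointHom (x : X) : ellOne PUnit.{u + 1} ⟶ X :=
  ellOneDesc (fun _ => x) (Set.finite_range _).isBounded

@[simp]
theorem pointHom_unitVec (x : X) (s : PUnit) : ellLin (pointHom x) (unitVec s) = x :=
  ellOneDesc_unitVec _ _ _

end CBorn

/-! ### Colimits of complete convex bornological spaces -/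

namespace CBorn

/-- The functor that forgets the bornology. -/
def toModuleCat : CBorn.{u} ⥤ ModuleCat.{u} ℝ where
  obj X := ModuleCat.of ℝ X
  map f := ModuleCat.ofHom (lin f)

theorem isBounded_unit_multiples {X : CBorn.{u}} (x : X) :
    Bornology.IsBounded ((fun t : ℝ => t • x) '' {t | |t| ≤ 1}) := by
  obtain ⟨E, _, _, _, Φ, h1, h2⟩ :=
    IsCompleteConvexBornology.exists_banach (Bornology.isBounded_singleton (x := x))
  refine h2.subset ?_
  rintro _ ⟨t, ht, rfl⟩
  exact (isDisk_image_closedBall Φ).balanced.smul_mem (a := t) ht (h1 rfl)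

section Colimits

variable {J : Type u} [SmallCategory J] (F : J ⥤ CBorn.{u})

/-- The colimit of the underlying vector spaces of a diagram. -/
noncomputable def ModColim : ModuleCat.{u} ℝ := colimit (F ⋙ toModuleCat)

/-- The linear maps into the colimit of the underlying vector spaces. -/
noncomputable def modι (j : J) : F.obj j →ₗ[ℝ] ModColim F :=
  ModuleCat.Hom.hom (colimit.ι (F ⋙ toModuleCat) j)

theorem modι_map {j k : J} (f : j ⟶ k) (x : F.obj j) :
    modι F k (lin (F.map f) x) = modι F j x :=
  LinearMap.congr_fun (congrArg ModuleCat.Hom.hom (colimit.w (F ⋙ toModuleCat) f)) x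

/-- The linear map out of the colimit of the underlying vector spaces defined by a cocone. -/
noncomputable def modDesc (s : Cocone F) : ModColim F →ₗ[ℝ] s.pt :=
  ModuleCat.Hom.hom (colimit.desc (F ⋙ toModuleCat) (toModuleCat.mapCocone s))

@[simp]
theorem modDesc_modι (s : Cocone F) (j : J) (x : F.obj j) :
    modDesc F s (modι F j x) = lin (s.ι.app j) x :=
  LinearMap.congr_fun (congrArg ModuleCat.Hom.hom
    (colimit.ι_desc (toModuleCat.mapCocone s) j)) x

theorem modColim_hom_ext {Z : Type u} [AddCommGroup Z] [Module ℝ Z] {g h : ModColim F →ₗ[ℝ] Z}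
    (e : ∀ j x, g (modι F j x) = h (modι F j x)) : g = h := by
  have : (ModuleCat.ofHom g : ModColim F ⟶ ModuleCat.of ℝ Z) = ModuleCat.ofHom h :=
    colimit.hom_ext fun j => ModuleCat.hom_ext (LinearMap.ext fun x => e j x)
  exact congrArg ModuleCat.Hom.hom this

/-- The vectors that no cocone separates from `0`. -/
noncomputable def nullSpace : Submodule ℝ (ModColim F) :=
  ⨅ s : Cocone F, LinearMap.ker (modDesc F s)

/-- The linear map out of the separated colimit defined by a cocone. -/
noncomputable def sepDesc (s : Cocone F) : (ModColim F ⧸ nullSpace F) →ₗ[ℝ] s.pt :=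
  (nullSpace F).liftQ (modDesc F s) (iInf_le _ s)

theorem eq_zero_of_sepDesc {v : ModColim F ⧸ nullSpace F} (h : ∀ s, sepDesc F s v = 0) :
    v = 0 := by
  obtain ⟨v, rfl⟩ := (nullSpace F).mkQ_surjective v
  refine (Submodule.Quotient.mk_eq_zero _).mpr ?_
  rw [nullSpace, Submodule.mem_iInf]
  exact h

/-- The bounded sets of the separated colimit: subsets of images of unit balls that every cocone
sends to bounded sets. -/
def sepBounded : Set (Set (ModColim F ⧸ nullSpace F)) :=
  {t | ∃ (E : Type u) (_ : NormedAddCommGroup E) (_ : NormedSpace ℝ E) (_ : CompleteSpace E)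
    (Φ : E →ₗ[ℝ] (ModColim F ⧸ nullSpace F)), t ⊆ Φ '' Metric.closedBall 0 1 ∧
      ∀ s : Cocone F, Bornology.IsBounded (sepDesc F s '' (Φ '' Metric.closedBall 0 1))}

theorem isBounded_image_sepDesc {t : Set (ModColim F ⧸ nullSpace F)} (ht : t ∈ sepBounded F)
    (s : Cocone F) : Bornology.IsBounded (sepDesc F s '' t) := by
  obtain ⟨E, _, _, _, Φ, h1, h2⟩ := ht
  exact (h2 s).subset (Set.image_mono h1)

/-- Separation is tested in the cocone points, because dividing by `nullSpace` makes the maps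
`sepDesc` jointly injective. -/
theorem isBoundedSystem_sepBounded : IsBoundedSystem (sepBounded F) where
  mono := by
    rintro s ⟨E, _, _, _, Φ, h1, h2⟩ t hts
    exact ⟨E, _, _, ‹_›, Φ, hts.trans h1, h2⟩
  singleton v := by
    refine ⟨ULift.{u} ℝ, inferInstance, inferInstance, inferInstance,
      (LinearMap.toSpanSingleton ℝ _ v).comp ULift.moduleEquiv.toLinearMap, ?_, fun s => ?_⟩
    · rintro _ rfl
      exact ⟨⟨1⟩, by simp [ULift.norm_def], one_smul ℝ _⟩
    · refine (isBounded_unit_multiples (sepDesc F s v)).subset ?_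
      rintro _ ⟨_, ⟨⟨e⟩, he, rfl⟩, rfl⟩
      exact ⟨e, by simpa [ULift.norm_def] using he, (map_smul _ _ _).symm⟩
  add := by
    rintro s ⟨E, _, _, _, Φ, h1, h2⟩ t ⟨G, _, _, _, Ψ, h3, h4⟩
    refine ⟨E × G, inferInstance, inferInstance, inferInstance, Φ.coprod Ψ, ?_, fun c => ?_⟩
    · rintro _ ⟨x, hx, y, hy, rfl⟩
      obtain ⟨e, he, rfl⟩ := h1 hx
      obtain ⟨f, hf, rfl⟩ := h3 hy
      rw [mem_closedBall_zero_iff] at he hf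
      exact ⟨(e, f), by simpa using ⟨he, hf⟩, by simp⟩
    · refine (IsCompleteConvexBornology.isBounded_add (h2 c) (h4 c)).subset ?_
      rintro _ ⟨_, ⟨⟨e, f⟩, h, rfl⟩, rfl⟩
      rw [mem_closedBall_zero_iff, Prod.norm_mk, sup_le_iff] at h
      exact ⟨_, ⟨Φ e, ⟨e, by simpa using h.1, rfl⟩, rfl⟩, _,
        ⟨Ψ f, ⟨f, by simpa using h.2, rfl⟩, rfl⟩, by simp⟩
  smul := by
    rintro s ⟨E, _, _, _, Φ, h1, h2⟩ r
    refine ⟨E, _, _, ‹_›, r • Φ, ?_, fun c => ?_⟩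
    · rintro _ ⟨x, hx, rfl⟩
      obtain ⟨e, he, rfl⟩ := h1 hx
      exact ⟨e, he, rfl⟩
    · refine (IsCompleteConvexBornology.isBounded_smul (h2 c) r).subset ?_
      rintro _ ⟨_, ⟨e, he, rfl⟩, rfl⟩
      exact ⟨_, ⟨_, ⟨e, he, rfl⟩, rfl⟩, by simp⟩
  sep t ht v hv := eq_zero_of_sepDesc F fun s =>
    IsCompleteConvexBornology.eq_zero_of_isBounded (isBounded_image_sepDesc F ht s) fun n =>
      ⟨_, hv n, by simp⟩
  exists_banach := by
    rintro s ⟨E, _, _, _, Φ, h1, h2⟩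
    exact ⟨E, _, _, ‹_›, Φ, h1, E, _, _, ‹_›, Φ, subset_rfl, h2⟩

/-- The colimit of a diagram of complete convex bornological spaces. -/
noncomputable def sepColim : CBorn.{u} := (isBoundedSystem_sepBounded F).toCBorn

theorem isBounded_sepColim_iff {t : Set (sepColim F)} :
    Bornology.IsBounded t ↔ t ∈ sepBounded F :=
  (isBoundedSystem_sepBounded F).isBounded_iff t

/-- The colimit cocone of a diagram of complete convex bornological spaces. -/
noncomputable def sepCocone : Cocone F where
  pt := sepColim F
  ι :=
    { app := fun j => homMk (Y := sepColim F) ((nullSpace F).mkQ.comp (modι F j)) fun s hs => by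
        rw [isBounded_sepColim_iff]
        obtain ⟨E, _, _, _, Φ, h1, h2⟩ := IsCompleteConvexBornology.exists_banach hs
        refine ⟨E, _, _, ‹_›, ((nullSpace F).mkQ.comp (modι F j)).comp Φ, ?_, fun c => ?_⟩
        · rw [LinearMap.coe_comp _ Φ, Set.image_comp]
          exact Set.image_mono h1
        · refine (isBounded_image_lin (c.ι.app j) h2).subset ?_
          rintro _ ⟨_, ⟨e, he, rfl⟩, rfl⟩
          exact ⟨_, ⟨e, he, rfl⟩, (modDesc_modι F c j _).symm⟩
      naturality := fun j k f => hom_ext fun x => congrArg (nullSpace F).mkQ (modι_map F f x) }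

/-- The cocone `sepCocone F` is a colimit cocone. -/
noncomputable def isColimitSepCocone : IsColimit (sepCocone F) where
  desc s := homMk (X := sepColim F) (sepDesc F s) fun t ht =>
    isBounded_image_sepDesc F ((isBounded_sepColim_iff F).mp ht) s
  fac s j := hom_ext fun x => modDesc_modι F s j x
  uniq s m hm := by
    have h : (lin m).comp (nullSpace F).mkQ = modDesc F s :=
      modColim_hom_ext F fun j x => (lin_congr (hm j) x).trans (modDesc_modι F s j x).symm
    refine hom_ext fun v => ?_
    obtain ⟨v, rfl⟩ := (nullSpace F).mkQ_surjective v
    exact LinearMap.congr_fun h v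

end Colimits

instance : HasColimitsOfSize.{u, u} CBorn.{u} where
  has_colimits_of_shape _ _ := { has_colimit := fun F => ⟨⟨_, isColimitSepCocone F⟩⟩ }

end CBorn

/-! ### Spaces generated by small `ℓ¹`-spaces -/

namespace CBorn

variable {X Y : CBorn.{u}}

/-- A scalar multiple of a morphism. -/
def smulHom (r : ℝ) (f : X ⟶ Y) : X ⟶ Y :=
  homMk (r • lin f) fun s hs => by
    refine (IsCompleteConvexBornology.isBounded_smul (isBounded_image_lin f hs) r).subset ?_
    rintro _ ⟨x, hx, rfl⟩
    exact ⟨_, ⟨x, hx, rfl⟩, rfl⟩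

theorem ballImage_smulHom {S : Type u} (r : ℝ) (f : ellOne S ⟶ X) :
    ballImage (smulHom r f) = r • ballImage f := by
  ext x
  constructor
  · rintro ⟨e, he, rfl⟩
    exact ⟨_, ⟨e, he, rfl⟩, rfl⟩
  · rintro ⟨_, ⟨e, he, rfl⟩, rfl⟩
    exact ⟨e, he, rfl⟩

/-- Functoriality of `ℓ¹(S)` in `S`. -/
theorem exists_apply_eq_of_unitVec_eq {S T : Type u} (τ : S → T) {f : ellOne S ⟶ X}
    {g : ellOne T ⟶ X} (h : ∀ s, ellLin g (unitVec (τ s)) = ellLin f (unitVec s))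
    (a : ℓ^1(S, ℝ)) : ∃ b : ℓ^1(T, ℝ), ‖b‖ ≤ ‖a‖ ∧ ellLin g b = ellLin f a := by
  obtain ⟨Ψ, hΨ, hs⟩ := exists_ellOne_continuousLinearMap (fun s => unitVec (τ s))
    fun s => (norm_unitVec _).le
  refine ⟨Ψ a, (Ψ.le_of_opNorm_le hΨ a).trans_eq (one_mul _), ?_⟩
  let i : ellOne S ⟶ ellOne T := ofBanachHom (X := ellOne T) (E := ℓ^1(S, ℝ)) Ψ.toLinearMap (by
    refine (Metric.isBounded_closedBall (x := (0 : ℓ^1(T, ℝ))) (r := 1)).subset ?_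
    rintro _ ⟨a, ha, rfl⟩
    rw [mem_closedBall_zero_iff] at ha
    refine mem_closedBall_zero_iff.mpr ?_
    exact (Ψ.le_of_opNorm_le hΨ a).trans (by simpa using ha))
  have hi : i ≫ g = f := ellOne_hom_ext fun s =>
    (congrArg (ellLin g) (hs s)).trans (h s)
  exact LinearMap.congr_fun (congrArg ellLin hi) a

theorem ballImage_subset_of_unitVec_eq {S T : Type u} (τ : S → T) {f : ellOne S ⟶ X}
    {g : ellOne T ⟶ X} (h : ∀ s, ellLin g (unitVec (τ s)) = ellLin f (unitVec s)) :
    ballImage f ⊆ ballImage g := by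
  rintro _ ⟨a, ha, rfl⟩
  obtain ⟨b, hb, hba⟩ := exists_apply_eq_of_unitVec_eq τ h a
  rw [mem_closedBall_zero_iff] at ha
  exact ⟨b, by simpa using hb.trans ha, hba⟩

theorem exists_ballImage_add_subset {S T : Type u} (f : ellOne S ⟶ X) (g : ellOne T ⟶ X) :
    ∃ h : ellOne (S ⊕ T) ⟶ X, ballImage f + ballImage g ⊆ ballImage h := by
  let x : S ⊕ T → X := Sum.elim (fun s => ellLin f (unitVec s)) fun t => ellLin g (unitVec t)
  have hx : Bornology.IsBounded (Set.range x) := by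
    rw [Set.Sum.elim_range]
    exact (isBounded_range_unitVec f).union (isBounded_range_unitVec g)
  -- The sum of two vectors of norm at most 1 may have norm 2 in `ℓ¹(S ⊕ T)`; the factor absorbs
  -- this.
  refine ⟨smulHom 2 (ellOneDesc x hx), ?_⟩
  rw [ballImage_smulHom]
  rintro _ ⟨_, ⟨a, ha, rfl⟩, _, ⟨b, hb, rfl⟩, rfl⟩
  obtain ⟨a', ha', h1⟩ := exists_apply_eq_of_unitVec_eq (g := ellOneDesc x hx) Sum.inl
    (fun s => ellOneDesc_unitVec x hx _) a
  obtain ⟨b', hb', h2⟩ := exists_apply_eq_of_unitVec_eq (g := ellOneDesc x hx) Sum.inr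
    (fun s => ellOneDesc_unitVec x hx _) b
  rw [mem_closedBall_zero_iff] at ha hb
  change ellLin f a + ellLin g b ∈ _
  rw [← h1, ← h2, ← map_add]
  exact apply_mem_smul_image_closedBall _ _ two_pos ((norm_add_le _ _).trans (by linarith))

/-- The spaces all of whose bounded sets are contained in the image of the unit ball of some
`ℓ¹(S)` with `#S < κ`. -/
def isGeneratedLT (κ : Cardinal.{u}) : ObjectProperty CBorn.{u} := fun X =>
  ∀ t : Set X, Bornology.IsBounded t → ∃ (S : Type u) (_ : #S < κ) (f : ellOne S ⟶ X),
    t ⊆ ballImage f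

theorem isGeneratedLT_ellOne {κ : Cardinal.{u}} {S : Type u} (hS : #S < κ) :
    isGeneratedLT κ (ellOne S) := by
  intro t ht
  obtain ⟨r, hr, htr⟩ := Bornology.IsBounded.subset_closedBall_lt (α := ℓ^1(S, ℝ)) ht 0 0
  refine ⟨S, hS, smulHom r (𝟙 _), ?_⟩
  rw [ballImage_smulHom]
  intro a ha
  exact apply_mem_smul_image_closedBall (ellLin (𝟙 (ellOne S))) a hr
    (mem_closedBall_zero_iff.mp (htr ha))

/-! ### The coreflection and stability under colimits and strict quotients -/

section Coreflection

variable {κ : Cardinal.{u}} (hκ : ℵ₀ ≤ κ) (X)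

include hκ in
theorem isBoundedSystem_generatedLT :
    IsBoundedSystem {t : Set X | ∃ (S : Type u) (_ : #S < κ) (f : ellOne S ⟶ X),
      t ⊆ ballImage f} where
  mono := by
    rintro s ⟨S, hS, f, hf⟩ t hts
    exact ⟨S, hS, f, hts.trans hf⟩
  singleton x := by
    refine ⟨PUnit, mk_lt_aleph0.trans_le hκ, pointHom x,
      Set.singleton_subset_iff.mpr ?_⟩
    simpa using apply_unitVec_mem_ballImage (pointHom x) PUnit.unit
  add := by
    rintro s ⟨S, hS, f, hf⟩ t ⟨T, hT, g, hg⟩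
    obtain ⟨h, hh⟩ := exists_ballImage_add_subset f g
    refine ⟨S ⊕ T, ?_, h, (Set.add_subset_add hf hg).trans hh⟩
    rw [← add_def]
    exact add_lt_of_lt hκ hS hT
  smul := by
    rintro s ⟨S, hS, f, hf⟩ r
    exact ⟨S, hS, smulHom r f, (Set.smul_set_mono hf).trans (ballImage_smulHom r f).ge⟩
  sep := by
    rintro s ⟨S, hS, f, hf⟩ v hv
    exact IsCompleteConvexBornology.eq_zero_of_isBounded (isBounded_ballImage f)
      fun n => hf (hv n)
  exists_banach := by
    rintro s ⟨S, hS, f, hf⟩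
    exact ⟨ℓ^1(S, ℝ), inferInstance, inferInstance, inferInstance, ellLin f, hf, S, hS, f,
      subset_rfl⟩

/-- The space `X` with the bornology generated by the images of the spaces `ℓ¹(S)` with
`#S < κ`. -/
noncomputable def coreflection : CBorn.{u} := (isBoundedSystem_generatedLT X hκ).toCBorn

theorem isBounded_coreflection_iff (t : Set X) :
    Bornology.IsBounded (α := coreflection X hκ) t ↔
      ∃ (S : Type u) (_ : #S < κ) (f : ellOne S ⟶ X), t ⊆ ballImage f :=
  (isBoundedSystem_generatedLT X hκ).isBounded_iff t

variable {X}

/-- The coreflection of a morphism out of a space generated by small `ℓ¹`-spaces. -/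
noncomputable def coreflectionLift (hY : isGeneratedLT κ Y) (f : Y ⟶ X) :
    Y ⟶ coreflection X hκ :=
  homMk (Y := coreflection X hκ) (lin f :) fun s hs => by
    obtain ⟨S, hS, g, hg⟩ := hY s hs
    refine (isBounded_coreflection_iff X hκ _).mpr ⟨S, hS, g ≫ f, ?_⟩
    rw [ballImage_comp]
    exact Set.image_mono hg

/-- The identity as a morphism from the coreflection. -/
noncomputable def coreflectionHom (X : CBorn.{u}) : coreflection X hκ ⟶ X :=
  homMk (X := coreflection X hκ) (LinearMap.id (R := ℝ) (M := X) :) fun s hs => by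
    obtain ⟨S, hS, g, hg⟩ := (isBounded_coreflection_iff X hκ _).mp hs
    refine (isBounded_ballImage g).subset ?_
    rintro _ ⟨x, hx, rfl⟩
    exact hg hx

/-- On vectors `coreflectionHom` is the identity, so a section of it says that bounded sets of `X`
stay bounded in the finer bornology. For colimits and strict quotients, the universal property
supplies such a section. -/
theorem isGeneratedLT_of_comp_coreflectionHom (g : X ⟶ coreflection X hκ)
    (hg : g ≫ coreflectionHom hκ X = 𝟙 X) : isGeneratedLT κ X := by
  intro t ht
  have h : lin g '' t = t := by
    have (x : X) : lin g x = x := lin_congr hg x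
    ext x
    constructor
    · rintro ⟨y, hy, rfl⟩
      rwa [this]
    · exact fun hx => ⟨x, hx, this x⟩
  exact (isBounded_coreflection_iff X hκ t).mp (h ▸ isBounded_image_lin g ht)

include hκ in
theorem isClosedUnderColimits_isGeneratedLT (J : Type*) [Category* J] :
    (isGeneratedLT κ).IsClosedUnderColimitsOfShape J where
  colimitsOfShape_le := by
    rintro X ⟨p⟩
    let s : Cocone p.diag :=
      { pt := coreflection X hκ
        ι :=
          { app := fun j => coreflectionLift hκ (p.prop_diag_obj j) (p.ι.app j)
            naturality := fun i j f => hom_ext fun x => lin_congr (p.ι.naturality f) x } }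
    refine isGeneratedLT_of_comp_coreflectionHom hκ (p.isColimit.desc s)
      (p.isColimit.hom_ext fun j => ?_)
    rw [p.isColimit.fac_assoc, Category.comp_id]
    rfl

include hκ in
theorem isGeneratedLT_of_isRegularEpi (hY : isGeneratedLT κ Y) (f : Y ⟶ X) [IsRegularEpi f] :
    isGeneratedLT κ X := by
  have w : IsRegularEpi.left f ≫ coreflectionLift hκ hY f =
      IsRegularEpi.right f ≫ coreflectionLift hκ hY f :=
    hom_ext fun x => lin_congr (IsRegularEpi.w f) x
  refine isGeneratedLT_of_comp_coreflectionHom hκ (IsRegularEpi.desc f _ w) ?_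
  have := (IsRegularEpi.getStruct f).epi
  rw [← cancel_epi f, ← Category.assoc, IsRegularEpi.fac, Category.comp_id]
  rfl

end Coreflection

/-- A morphism that is surjective on bounded sets is a regular epimorphism. -/
theorem isRegularEpi_of_isBounded_lift (f : Y ⟶ X)
    (hf : ∀ t : Set X, Bornology.IsBounded t →
      ∃ s : Set Y, Bornology.IsBounded s ∧ t ⊆ lin f '' s) : IsRegularEpi f := by
  have hsurj : Function.Surjective (lin f) := fun x => by
    obtain ⟨s, -, h⟩ := hf {x} Bornology.isBounded_singleton
    obtain ⟨y, -, hy⟩ := h rfl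
    exact ⟨y, hy⟩
  -- With one copy of `ℓ¹` of a point per kernel vector, a cofork on `l` and `r` is exactly a
  -- morphism that vanishes on the kernel of `f`.
  let l : (∐ fun _ : LinearMap.ker (lin f) => ellOne PUnit.{u + 1}) ⟶ Y :=
    Sigma.desc fun k => pointHom k.1
  let r : (∐ fun _ : LinearMap.ker (lin f) => ellOne PUnit.{u + 1}) ⟶ Y :=
    Sigma.desc fun _ => pointHom 0
  have w : l ≫ f = r ≫ f := by
    refine Sigma.hom_ext _ _ fun k => ?_
    rw [Sigma.ι_desc_assoc, Sigma.ι_desc_assoc]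
    refine ellOne_hom_ext fun s => ?_
    rw [ellLin_comp, ellLin_comp, pointHom_unitVec, pointHom_unitVec, map_zero]
    exact k.2
  have hker (s : Cofork l r) (y : Y) (hy : lin f y = 0) : lin s.π y = 0 := by
    have h := congrArg (fun g => Sigma.ι _ (⟨y, hy⟩ : LinearMap.ker (lin f)) ≫ g) s.condition
    simp only [l, r, Sigma.ι_desc_assoc] at h
    have h' := LinearMap.congr_fun (congrArg ellLin h) (unitVec PUnit.unit)
    rwa [ellLin_comp, ellLin_comp, pointHom_unitVec, pointHom_unitVec, map_zero] at h'
  have heq (s : Cofork l r) (y y' : Y) (h : lin f y = lin f y') : lin s.π y = lin s.π y' := by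
    rw [← sub_eq_zero, ← map_sub] at h ⊢
    exact hker s _ h
  have hinv (x : X) : lin f (Function.surjInv hsurj x) = x := Function.surjInv_eq hsurj x
  let d (s : Cofork l r) : X →ₗ[ℝ] s.pt :=
    { toFun := fun x => lin s.π (Function.surjInv hsurj x)
      map_add' := fun x y => by
        rw [← map_add]
        exact heq s _ _ (by rw [map_add, hinv, hinv, hinv])
      map_smul' := fun c x => by
        rw [RingHom.id_apply, ← map_smul]
        exact heq s _ _ (by rw [map_smul, hinv, hinv]) }
  have hd (s : Cofork l r) (y : Y) : d s (lin f y) = lin s.π y := heq s _ _ (hinv _)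
  refine ⟨⟨⟨_, l, r, w, Cofork.IsColimit.mk _ (fun s => homMk (d s) fun t ht => ?_)
    (fun s => ?_) (fun s m hm => ?_)⟩⟩⟩
  · obtain ⟨b, hb, htb⟩ := hf t ht
    refine (isBounded_image_lin s.π hb).subset ?_
    rintro _ ⟨x, hx, rfl⟩
    obtain ⟨y, hy, rfl⟩ := htb hx
    exact ⟨y, hy, (hd s y).symm⟩
  · exact hom_ext (hd s)
  · refine hom_ext fun x => ?_
    obtain ⟨y, rfl⟩ := hsurj x
    exact (lin_congr hm y).trans (hd s y).symm

/-- Taking index sets inside the fixed set `κ.out` leaves only a small family of spaces `ℓ¹(S)`, as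
needed for the coproduct below and for the generator. -/
theorem exists_subset_ballImage_of_isGeneratedLT {κ : Cardinal.{u}} (hX : isGeneratedLT κ X)
    {t : Set X} (ht : Bornology.IsBounded t) :
    ∃ (S : {S : Set κ.out // #S < κ}) (f : ellOne S.1 ⟶ X), t ⊆ ballImage f := by
  obtain ⟨S, hS, f, hf⟩ := hX t ht
  obtain ⟨e⟩ : Nonempty (S ↪ κ.out) := by
    rw [← Cardinal.le_def, mk_out]
    exact hS.le
  let σ := Equiv.ofInjective e e.injective
  have hb : Bornology.IsBounded (Set.range fun s => ellLin f (unitVec (σ.symm s))) :=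
    (isBounded_range_unitVec f).subset (by
      rintro _ ⟨s, rfl⟩
      exact ⟨_, rfl⟩)
  exact ⟨⟨Set.range e, by rwa [mk_range_eq _ e.injective]⟩, ellOneDesc _ hb,
    hf.trans (ballImage_subset_of_unitVec_eq σ fun s =>
      (ellOneDesc_unitVec _ hb _).trans (by rw [σ.symm_apply_apply]))⟩

/-- For the converse, sum over all morphisms `ℓ¹(S) ⟶ X` with `S` a small subset of `κ.out`; by
assumption the result is surjective on bounded sets. -/
theorem isQuotientOfSum_iff {κ : Cardinal.{u}} (hκ : ℵ₀ ≤ κ) (X : CBorn.{u}) :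
    isQuotientOfSum κ X ↔ isGeneratedLT κ X := by
  constructor
  · rintro ⟨I, S, hS, c, hc, f, _⟩
    have := isClosedUnderColimits_isGeneratedLT hκ (Discrete I)
    exact isGeneratedLT_of_isRegularEpi hκ
      (ObjectProperty.prop_of_isColimit _ hc fun i => isGeneratedLT_ellOne (hS i.as)) f
  · intro hX
    let I := Σ S : {S : Set κ.out // #S < κ}, (ellOne S.1 ⟶ X)
    refine ⟨I, fun i => i.1.1, fun i => i.1.2, _,
      coproductIsCoproduct fun i : I => ellOne i.1.1, Sigma.desc fun i => i.2,
      isRegularEpi_of_isBounded_lift _ fun t ht => ?_⟩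
    obtain ⟨S, f, hf⟩ := exists_subset_ballImage_of_isGeneratedLT hX ht
    refine ⟨ballImage (Sigma.ι (fun i : I => ellOne i.1.1) ⟨S, f⟩), isBounded_ballImage _, ?_⟩
    rwa [← ballImage_comp, Sigma.ι_desc]

end CBorn

/-! ### Filtered colimits -/

namespace CBorn

section Filtered

variable {J : Type u} [SmallCategory J] [IsFiltered J] (F : J ⥤ CBorn.{u})

instance : PreservesColimitsOfShape J (forget (ModuleCat.{u} ℝ)) :=
  inferInstanceAs (PreservesColimitsOfShape J
    (forget₂ (ModuleCat.{u} ℝ) AddCommGrpCat.{u} ⋙ forget AddCommGrpCat.{u}))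

theorem modι_jointly_surjective (v : ModColim F) : ∃ j x, modι F j x = v :=
  Concrete.isColimit_exists_rep (F ⋙ toModuleCat) (colimit.isColimit _) v

theorem exists_map_eq_zero_of_modι {j : J} {x : F.obj j} (h : modι F j x = 0) :
    ∃ (k : J) (f : j ⟶ k), lin (F.map f) x = 0 := by
  obtain ⟨k, f, g, hfg⟩ := Concrete.isColimit_exists_of_rep_eq (F ⋙ toModuleCat)
    (colimit.isColimit _) (i := j) (j := j) x (0 : F.obj j)
    (h.trans (map_zero (modι F j)).symm)
  exact ⟨k, f, (hfg : lin (F.map f) x = lin (F.map g) 0).trans (map_zero _)⟩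

/-- The condition for the filtered colimit of the underlying vector spaces of a diagram to be
separated. -/
def HasSeparatedColimit : Prop :=
  ∀ (j : J) (b : Set (F.obj j)), Bornology.IsBounded b → ∀ y : F.obj j,
    (∀ n : ℕ, ∃ x ∈ b, ∃ (k : J) (f : j ⟶ k), lin (F.map f) ((n : ℝ) • y - x) = 0) →
      ∃ (k : J) (f : j ⟶ k), lin (F.map f) y = 0

variable {F}

theorem isBoundedSystem_filtered (hF : HasSeparatedColimit F) :
    IsBoundedSystem {t : Set (ModColim F) |
      ∃ (j : J) (b : Set (F.obj j)), Bornology.IsBounded b ∧ t ⊆ modι F j '' b} where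
  mono := by
    rintro s ⟨j, b, hb, h⟩ t hts
    exact ⟨j, b, hb, hts.trans h⟩
  singleton v := by
    obtain ⟨j, x, rfl⟩ := modι_jointly_surjective F v
    exact ⟨j, {x}, Bornology.isBounded_singleton, by simp⟩
  add := by
    rintro s ⟨i, b, hb, hs⟩ t ⟨j, c, hc, ht⟩
    refine ⟨IsFiltered.max i j, _, IsCompleteConvexBornology.isBounded_add
      (isBounded_image_lin (F.map (IsFiltered.leftToMax i j)) hb)
      (isBounded_image_lin (F.map (IsFiltered.rightToMax i j)) hc), ?_⟩
    rintro _ ⟨v, hv, w, hw, rfl⟩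
    obtain ⟨x, hx, rfl⟩ := hs hv
    obtain ⟨y, hy, rfl⟩ := ht hw
    exact ⟨_, ⟨_, ⟨x, hx, rfl⟩, _, ⟨y, hy, rfl⟩, rfl⟩, by simp [modι_map]⟩
  smul := by
    rintro s ⟨j, b, hb, hs⟩ r
    refine ⟨j, _, IsCompleteConvexBornology.isBounded_smul hb r, ?_⟩
    rintro _ ⟨v, hv, rfl⟩
    obtain ⟨x, hx, rfl⟩ := hs hv
    exact ⟨_, ⟨x, hx, rfl⟩, by simp⟩
  sep := by
    rintro s ⟨j, b, hb, hs⟩ v hv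
    obtain ⟨y, -, rfl⟩ := hs (by simpa using hv 1)
    obtain ⟨k, f, h⟩ := hF j b hb y fun n => by
      obtain ⟨x, hx, h⟩ := hs (hv n)
      exact ⟨x, hx, exists_map_eq_zero_of_modι F (by rw [map_sub, map_smul, h, sub_self])⟩
    rw [← modι_map F f, h, map_zero]
  exists_banach := by
    rintro s ⟨j, b, hb, hs⟩
    obtain ⟨E, _, _, _, Φ, h1, h2⟩ := IsCompleteConvexBornology.exists_banach hb
    refine ⟨E, _, _, ‹_›, (modι F j).comp Φ, ?_, j, _, h2, ?_⟩
    · rw [LinearMap.coe_comp, Set.image_comp]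
      exact hs.trans (Set.image_mono h1)
    · rw [LinearMap.coe_comp, Set.image_comp]

/-- The filtered colimit of the underlying vector spaces with the bornology generated by the images
of the bounded sets. -/
noncomputable def filteredColim (hF : HasSeparatedColimit F) : CBorn.{u} :=
  (isBoundedSystem_filtered hF).toCBorn

theorem isBounded_filteredColim_iff (hF : HasSeparatedColimit F) (t : Set (ModColim F)) :
    Bornology.IsBounded (α := filteredColim hF) t ↔
      ∃ (j : J) (b : Set (F.obj j)), Bornology.IsBounded b ∧ t ⊆ modι F j '' b :=
  (isBoundedSystem_filtered hF).isBounded_iff t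

/-- The colimit cocone of a filtered diagram with separated colimit. -/
noncomputable def filteredCocone (hF : HasSeparatedColimit F) : Cocone F where
  pt := filteredColim hF
  ι :=
    { app := fun j => homMk (Y := filteredColim hF) (modι F j) fun s hs =>
        (isBounded_filteredColim_iff hF _).mpr ⟨j, s, hs, subset_rfl⟩
      naturality := fun _ _ f => hom_ext fun x => modι_map F f x }

/-- The cocone `filteredCocone hF` is a colimit cocone. -/
noncomputable def isColimitFilteredCocone (hF : HasSeparatedColimit F) :
    IsColimit (filteredCocone hF) where
  desc s := homMk (X := filteredColim hF) (modDesc F s) fun t ht => by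
    obtain ⟨j, b, hb, htb⟩ := (isBounded_filteredColim_iff hF _).mp ht
    refine (isBounded_image_lin (s.ι.app j) hb).subset ?_
    rintro _ ⟨v, hv, rfl⟩
    obtain ⟨x, hx, rfl⟩ := htb hv
    exact ⟨x, hx, (modDesc_modι F s j x).symm⟩
  fac s j := hom_ext fun x => modDesc_modι F s j x
  uniq s m hm := lin_injective (modColim_hom_ext F fun j x =>
    (lin_congr (hm j) x).trans (modDesc_modι F s j x).symm)

variable {c : Cocone F} (hF : HasSeparatedColimit F) (hc : IsColimit c)

include hF hc

theorem exists_bounded_lift_of_isColimit {t : Set c.pt} (ht : Bornology.IsBounded t) :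
    ∃ (j : J) (b : Set (F.obj j)), Bornology.IsBounded b ∧ t ⊆ lin (c.ι.app j) '' b := by
  let e := hc.coconePointUniqueUpToIso (isColimitFilteredCocone hF)
  obtain ⟨j, b, hb, h⟩ := (isBounded_filteredColim_iff hF _).mp (isBounded_image_lin e.hom ht)
  refine ⟨j, b, hb, fun v hv => ?_⟩
  obtain ⟨x, hx, hxv⟩ := h ⟨v, hv, rfl⟩
  refine ⟨x, hx, ?_⟩
  have h1 : (filteredCocone hF).ι.app j ≫ e.inv = c.ι.app j :=
    hc.comp_coconePointUniqueUpToIso_inv (isColimitFilteredCocone hF) j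
  refine (lin_congr h1 x).symm.trans ((congrArg (lin e.inv) hxv).trans ?_)
  exact lin_congr e.hom_inv_id v

theorem exists_map_eq_zero_of_isColimit {j : J} {x : F.obj j} (h : lin (c.ι.app j) x = 0) :
    ∃ (k : J) (f : j ⟶ k), lin (F.map f) x = 0 := by
  refine exists_map_eq_zero_of_modι F ?_
  let e := hc.coconePointUniqueUpToIso (isColimitFilteredCocone hF)
  have h1 : c.ι.app j ≫ e.hom = (filteredCocone hF).ι.app j :=
    hc.comp_coconePointUniqueUpToIso_hom (isColimitFilteredCocone hF) j
  exact (lin_congr h1 x).symm.trans ((congrArg (lin e.hom) h).trans (map_zero _))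

/-- The whole bounded family of images of unit vectors lifts to one stage at once, so `S` may be
arbitrarily large; its size matters only for uniqueness of lifts. -/
theorem exists_ellOne_lift {S : Type u} (g : ellOne S ⟶ c.pt) :
    ∃ (j : J) (g' : ellOne S ⟶ F.obj j), g' ≫ c.ι.app j = g := by
  obtain ⟨j, b, hb, h⟩ := exists_bounded_lift_of_isColimit hF hc (isBounded_range_unitVec g)
  choose x hx hxg using fun s => h ⟨s, rfl⟩
  have hb' : Bornology.IsBounded (Set.range x) := hb.subset (Set.range_subset_iff.mpr hx)
  exact ⟨j, ellOneDesc x hb', ellOne_hom_ext fun s =>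
    (congrArg (lin (c.ι.app j)) (ellOneDesc_unitVec x hb' s)).trans (hxg s)⟩

end Filtered

/-! ### Separatedness and uniqueness of lifts for `κ`-filtered diagrams -/

section CardinalFiltered

variable {J : Type u} [SmallCategory J] {F : J ⥤ CBorn.{u}} {κ : Cardinal.{u}}
  [Fact κ.IsRegular] [IsCardinalFiltered J κ]

variable (κ) in
include κ in
/-- Vectors that die in a family of stages die in a common stage. -/
theorem exists_common_map_eq_zero {j : J} {S : Type u} (hS : #S < κ) (x : S → F.obj j)
    (h : ∀ s, ∃ (k : J) (f : j ⟶ k), lin (F.map f) (x s) = 0) :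
    ∃ (k : J) (f : j ⟶ k), ∀ s, lin (F.map f) (x s) = 0 := by
  choose k f hf using h
  obtain ⟨m, a, b, hab⟩ := IsCardinalFiltered.wideSpan (κ := κ) f
    (by rwa [hasCardinalLT_iff_cardinal_mk_lt])
  refine ⟨m, b, fun s => ?_⟩
  rw [← hab s, F.map_comp, lin_comp, LinearMap.comp_apply, hf, map_zero]

-- The relations `n • y = x n` are countably many, so they hold together at one stage. There the
-- image of `b` contains all multiples `n • y`, and `y` dies.
variable (F) in
theorem hasSeparatedColimit_of_aleph0_lt (hκ : ℵ₀ < κ) : HasSeparatedColimit F := by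
  intro j b hb y h
  choose x hx h using h
  obtain ⟨k, f, hf⟩ := exists_common_map_eq_zero κ (S := ULift.{u} ℕ) (by simpa using hκ)
    (fun n => (n.down : ℝ) • y - x n.down) fun n => h n.down
  refine ⟨k, f, IsCompleteConvexBornology.eq_zero_of_isBounded
    (isBounded_image_lin (F.map f) hb) fun n => ⟨x n, hx n, ?_⟩⟩
  have := hf ⟨n⟩
  rw [map_sub, map_smul, sub_eq_zero] at this
  exact this.symm

-- Infinitely many relations need not hold at a common stage here. Instead, `b` lies in the image of
-- a finite-dimensional `ℓ¹(S)`, where the kernel `K` of the map to the colimit is automatically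
-- closed.
omit [IsCardinalFiltered J κ] in
variable (F) in
theorem hasSeparatedColimit_of_isGeneratedLT_aleph0 [IsFiltered J]
    (hF : ∀ j, isGeneratedLT ℵ₀ (F.obj j)) : HasSeparatedColimit F := by
  intro j b hb y h
  obtain ⟨S, hS, g, hg⟩ := hF j b hb
  have : Finite S := lt_aleph0_iff_finite.mp hS
  have : FiniteDimensional ℝ ℓ^1(S, ℝ) :=
    have := Fintype.ofFinite S
    (lpPiLpₗᵢ (p := 1) (fun _ : S => ℝ) ℝ).symm.toLinearEquiv.finiteDimensional
  let K : Submodule ℝ ℓ^1(S, ℝ) := LinearMap.ker ((modι F j).comp (ellLin g))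
  have hK : IsClosed (K : Set ℓ^1(S, ℝ)) := K.closed_of_finiteDimensional
  choose x hx h using h
  choose e he hex using fun n => hg (hx n)
  have hz (n : ℕ) : (n : ℝ) • modι F j y = modι F j (ellLin g (e n)) := by
    obtain ⟨k, f, hf⟩ := h n
    rw [hex, ← map_smul, ← sub_eq_zero, ← map_sub, ← modι_map F f, hf, map_zero]
  -- Both terms represent the class of `y`, and the second tends to 0 because the `e n` stay in the
  -- unit ball; so `e 1` lies in `K`.
  have hmem (n : ℕ) : e 1 - ((n : ℝ) + 1)⁻¹ • e (n + 1) ∈ K := by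
    have h1 := hz 1
    have h2 := hz (n + 1)
    change modι F j (ellLin g (e 1 - ((n : ℝ) + 1)⁻¹ • e (n + 1))) = 0
    rw [map_sub, map_sub, map_smul, map_smul, ← h1, ← h2, smul_smul]
    push_cast
    rw [inv_mul_cancel₀ (by positivity), sub_self]
  have hlim : Tendsto (fun n : ℕ => e 1 - ((n : ℝ) + 1)⁻¹ • e (n + 1)) atTop (𝓝 (e 1)) := by
    rw [tendsto_iff_norm_sub_tendsto_zero]
    refine squeeze_zero (fun _ => norm_nonneg _) (fun n => ?_)
      tendsto_one_div_add_atTop_nhds_zero_nat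
    have := he (n + 1)
    rw [mem_closedBall_zero_iff] at this
    rw [sub_sub_cancel_left, norm_neg, norm_smul, norm_inv, Real.norm_of_nonneg (by positivity),
      one_div]
    exact mul_le_of_le_one_right (by positivity) this
  have h1 : e 1 ∈ K := hK.mem_of_tendsto hlim (Eventually.of_forall hmem)
  refine exists_map_eq_zero_of_modι F ?_
  have h2 := hz 1
  rw [Nat.cast_one, one_smul] at h2
  exact h2.trans h1

theorem exists_map_eq_of_comp_eq [IsFiltered J] {c : Cocone F} (hF : HasSeparatedColimit F)
    (hc : IsColimit c) {S : Type u} (hS : #S < κ) {j : J} (f g : ellOne S ⟶ F.obj j)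
    (h : f ≫ c.ι.app j = g ≫ c.ι.app j) :
    ∃ (k : J) (a : j ⟶ k), f ≫ F.map a = g ≫ F.map a := by
  obtain ⟨k, a, ha⟩ := exists_common_map_eq_zero κ hS
    (fun s => ellLin f (unitVec s) - ellLin g (unitVec s)) fun s =>
      exists_map_eq_zero_of_isColimit hF hc (by
        rw [map_sub, sub_eq_zero]
        exact LinearMap.congr_fun (congrArg ellLin h) (unitVec s))
  refine ⟨k, a, ellOne_hom_ext fun s => ?_⟩
  have := ha s
  rwa [map_sub, sub_eq_zero] at this

end CardinalFiltered

end CBorn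

/-! ### Presentability and the strong generator -/

theorem isCardinalPresentable_of_exists_lift {C : Type*} [Category.{u} C] (X : C)
    (κ : Cardinal.{u}) [Fact κ.IsRegular]
    (h : ∀ (J : Type u) [SmallCategory J] [IsCardinalFiltered J κ] (F : J ⥤ C) (c : Cocone F),
      IsColimit c → (∀ f : X ⟶ c.pt, ∃ (j : J) (g : X ⟶ F.obj j), g ≫ c.ι.app j = f) ∧
        ∀ (j : J) (f g : X ⟶ F.obj j), f ≫ c.ι.app j = g ≫ c.ι.app j →
          ∃ (k : J) (a : j ⟶ k), f ≫ F.map a = g ≫ F.map a) :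
    IsCardinalPresentable X κ where
  preservesColimitOfShape J _ _ := ⟨fun {F} => ⟨fun {c} hc => by
    have := isFiltered_of_isCardinalFiltered J κ
    refine ⟨Types.FilteredColimit.isColimitOf' _ _ (fun f => ?_) fun j f g hfg => ?_⟩
    · obtain ⟨j, g, hg⟩ := (h J F c hc).1 f
      exact ⟨j, g, hg.symm⟩
    · exact (h J F c hc).2 j f g hfg⟩⟩

namespace CBorn

variable {κ : Cardinal.{u}} [Fact κ.IsRegular]

theorem aleph0_le_of_isRegular (κ : Cardinal.{u}) [Fact κ.IsRegular] : ℵ₀ ≤ κ :=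
  (Fact.out : κ.IsRegular).aleph0_le

instance isClosedUnderColimits_isQuotientOfSum (J : Type*) [Category* J] :
    (isQuotientOfSum κ).IsClosedUnderColimitsOfShape J := by
  have hκ := aleph0_le_of_isRegular κ
  have : isQuotientOfSum κ = isGeneratedLT κ := funext fun X => propext (isQuotientOfSum_iff hκ X)
  rw [this]
  exact isClosedUnderColimits_isGeneratedLT hκ J

instance : HasColimitsOfSize.{u, u} (CBornLT κ) where

/-- The space `ℓ¹(S)` with `#S < κ` as an object of `CBornLT κ`. -/
noncomputable def ellOneLT {S : Type u} (hS : #S < κ) : CBornLT κ :=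
  ⟨ellOne S, (isQuotientOfSum_iff (aleph0_le_of_isRegular κ) _).mpr (isGeneratedLT_ellOne hS)⟩

theorem isGeneratedLT_obj (X : CBornLT κ) : isGeneratedLT κ X.obj :=
  (isQuotientOfSum_iff (aleph0_le_of_isRegular κ) _).mp X.property

/-- The inclusion into `CBorn` preserves colimits, so the analysis there applies. For `κ = ℵ₀`
separatedness uses that the stages lie in `CBornLT ℵ₀`. -/
theorem isCardinalPresentable_ellOneLT {S : Type u} (hS : #S < κ) :
    IsCardinalPresentable (ellOneLT hS) κ :=
  isCardinalPresentable_of_exists_lift _ _ fun J _ _ F c hc => by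
    have := isFiltered_of_isCardinalFiltered J κ
    have hF : HasSeparatedColimit (F ⋙ (isQuotientOfSum κ).ι) := by
      obtain h | rfl := (aleph0_le_of_isRegular κ).lt_or_eq
      · exact hasSeparatedColimit_of_aleph0_lt _ h
      · exact hasSeparatedColimit_of_isGeneratedLT_aleph0 _ fun j => isGeneratedLT_obj (F.obj j)
    have hc' := isColimitOfPreserves (isQuotientOfSum κ).ι hc
    refine ⟨fun f => ?_, fun j f g h => ?_⟩
    · obtain ⟨j, g, hg⟩ := exists_ellOne_lift hF hc' f.hom
      exact ⟨j, ObjectProperty.homMk g, ObjectProperty.hom_ext _ hg⟩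
    · obtain ⟨k, a, ha⟩ := exists_map_eq_of_comp_eq hF hc' hS f.hom g.hom
        (congrArg (fun x => x.hom) h)
      exact ⟨k, a, ObjectProperty.hom_ext _ ha⟩

/-- The spaces `ℓ¹(S)` for the small subsets `S` of a set of cardinality `κ`. -/
def smallEllOne (κ : Cardinal.{u}) [Fact κ.IsRegular] : ObjectProperty (CBornLT κ) :=
  .ofObj fun S : {S : Set κ.out // #S < κ} => ellOneLT S.2

instance : ObjectProperty.Small.{u} (smallEllOne κ) := by
  unfold smallEllOne
  infer_instance

/-- If all morphisms from the generators lift along a monomorphism `i`, then `i` is surjective on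
bounded sets; testing against `ℓ¹` of a point shows it injective. -/
theorem isStrongGenerator_smallEllOne : (smallEllOne κ).IsStrongGenerator := by
  rw [ObjectProperty.isStrongGenerator_iff]
  constructor
  · intro X Y f g h
    refine ObjectProperty.hom_ext _ (hom_ext fun x => ?_)
    obtain ⟨S, p, hp⟩ := exists_subset_ballImage_of_isGeneratedLT (isGeneratedLT_obj X)
      (Bornology.isBounded_singleton (x := x))
    obtain ⟨a, -, rfl⟩ := hp rfl
    have := h (ellOneLT S.2) ⟨S⟩ (ObjectProperty.homMk p)
    exact LinearMap.congr_fun (congrArg (fun q => ellLin q.hom) this) a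
  · intro X Y i _ h
    have hb (t : Set Y.obj) (ht : Bornology.IsBounded t) :
        ∃ s : Set X.obj, Bornology.IsBounded s ∧ t ⊆ lin i.hom '' s := by
      obtain ⟨S, p, hp⟩ := exists_subset_ballImage_of_isGeneratedLT (isGeneratedLT_obj Y) ht
      obtain ⟨q, hq⟩ := h (ellOneLT S.2) ⟨S⟩ (ObjectProperty.homMk p)
      have hq' : q.hom ≫ i.hom = p := congrArg (fun x => x.hom) hq
      have e := ballImage_comp (S := S.1) (X := X.obj) (Y := Y.obj) q.hom i.hom
      exact ⟨_, isBounded_ballImage (S := S.1) q.hom,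
        hp.trans ((congrArg (ballImage (S := S.1)) hq').symm.trans e).le⟩
    have : IsIso ((isQuotientOfSum κ).ι.map i) := by
      refine isIso_of_lin_bijective i.hom ⟨?_, fun y => ?_⟩ hb
      · rw [injective_iff_map_eq_zero]
        intro x hx
        have hP : #PUnit.{u + 1} < κ := mk_lt_aleph0.trans_le (aleph0_le_of_isRegular κ)
        let p : ellOneLT hP ⟶ X := ObjectProperty.homMk (pointHom x)
        let z : ellOneLT hP ⟶ X := ObjectProperty.homMk (pointHom 0)
        have h1 : p ≫ i = z ≫ i := ObjectProperty.hom_ext _ (ellOne_hom_ext (X := Y.obj) fun s => by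
          change lin i.hom (ellLin (pointHom x) _) = lin i.hom (ellLin (pointHom 0) _)
          rw [pointHom_unitVec, pointHom_unitVec, hx, map_zero])
        have h2 : pointHom x = pointHom 0 := congrArg (fun q => q.hom) ((cancel_mono i).mp h1)
        rw [← pointHom_unitVec x PUnit.unit, h2, pointHom_unitVec]
      · obtain ⟨s, -, hs⟩ := hb {y} Bornology.isBounded_singleton
        obtain ⟨x, -, hx⟩ := hs rfl
        exact ⟨x, hx⟩
    exact isIso_of_reflects_iso i (isQuotientOfSum κ).ι

theorem isCardinalLocallyPresentable_cbornLT : IsCardinalLocallyPresentable (CBornLT κ) κ := by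
  rw [IsCardinalLocallyPresentable.iff_exists_isStrongGenerator]
  refine ⟨smallEllOne κ, inferInstance, isStrongGenerator_smallEllOne, ?_⟩
  rintro _ ⟨S⟩
  exact isCardinalPresentable_ellOneLT S.2

end CBorn

/-! ### Banach spaces of small density character -/

theorem exists_dense_of_densityCharacter_lt {E : Type u} [TopologicalSpace E] {κ : Cardinal.{u}}
    (h : densityCharacter E < κ) : ∃ s : Set E, Dense s ∧ #s < κ := by
  obtain ⟨s, hs, hc⟩ := csInf_mem (s := {c | ∃ s : Set E, Dense s ∧ #s = c})
    ⟨_, Set.univ, dense_univ, rfl⟩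
  exact ⟨s, hs, hc.trans_lt h⟩

/-- Integer coefficients keep the span smaller than `κ`, which real ones need not do when `κ` is at
most the continuum. An additive subgroup suffices for the density arguments. -/
theorem mk_span_int_lt {E : Type u} [AddCommGroup E] {s : Set E} {κ : Cardinal.{u}} (hκ : ℵ₀ < κ)
    (hs : #s < κ) : #(Submodule.span ℤ s) < κ := by
  have h : #(Submodule.span ℤ s) ≤ #(s →₀ ℤ) := by
    refine mk_le_of_surjective (f := fun l => ⟨Finsupp.linearCombination ℤ (↑) l, ?_⟩) ?_
    · exact (Finsupp.mem_span_iff_linearCombination ℤ s _).mpr ⟨l, rfl⟩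
    · rintro ⟨x, hx⟩
      obtain ⟨l, hl⟩ := (Finsupp.mem_span_iff_linearCombination ℤ s x).mp hx
      exact ⟨l, Subtype.ext hl⟩
  refine h.trans_lt ?_
  cases isEmpty_or_nonempty s
  · exact (mk_lt_aleph0).trans hκ
  · rw [mk_finsupp_lift_of_infinite']
    simpa using ⟨hs, hκ⟩

/-- Subsets of a space with a small dense subset have small dense subsets. -/
theorem exists_subset_closure_of_dense {M : Type u} [PseudoMetricSpace M] {Q : Set M}
    (hQ : Dense Q) {κ : Cardinal.{u}} (hκ : ℵ₀ < κ) (hQκ : #Q < κ) (A : Set M) :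
    ∃ T ⊆ A, #T < κ ∧ A ⊆ closure T := by
  -- One point of `A` is chosen in each ball that meets `A`, among those with centre in `Q` and
  -- radius `1 / (n + 1)`.
  let I := {p : Q × ULift.{u} ℕ // (A ∩ Metric.ball p.1.1 (1 / ((p.2.down : ℝ) + 1))).Nonempty}
  choose x hx using fun i : I => i.2
  refine ⟨Set.range x, Set.range_subset_iff.mpr fun i => (hx i).1, ?_, fun a ha => ?_⟩
  · refine mk_range_le.trans_lt ((mk_subtype_le _).trans_lt ?_)
    rw [mk_prod, Cardinal.lift_id, Cardinal.lift_id]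
    exact mul_lt_of_lt hκ.le hQκ (by simpa using hκ)
  · rw [Metric.mem_closure_iff]
    intro ε hε
    obtain ⟨n, hn⟩ := exists_nat_one_div_lt (half_pos hε)
    obtain ⟨q, hq, hqa⟩ := hQ.exists_dist_lt a (Nat.one_div_pos_of_nat (n := n) (α := ℝ))
    let i : I := ⟨(⟨q, hq⟩, ⟨n⟩), a, ha, hqa⟩
    refine ⟨x i, ⟨i, rfl⟩, ?_⟩
    have h1 : dist (x i) q < 1 / ((n : ℝ) + 1) := (hx i).2
    calc dist a (x i) ≤ dist a q + dist (x i) q := dist_triangle_right _ _ _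
      _ < ε := by linarith

namespace CBorn

theorem exists_dense_ellOne {S : Type u} {κ : Cardinal.{u}} (hκ : ℵ₀ < κ) (hS : #S < κ) :
    ∃ Q : Set ℓ^1(S, ℝ), Dense Q ∧ #Q < κ := by
  classical
  let s : Set ℓ^1(S, ℝ) := Set.range fun p : S × ULift.{u} ℚ => (p.2.down : ℝ) • unitVec p.1
  have hs : #s < κ := by
    refine mk_range_le.trans_lt ?_
    rw [mk_prod, Cardinal.lift_id, Cardinal.lift_id]
    exact mul_lt_of_lt hκ.le hS (by simpa using hκ)
  refine ⟨Submodule.span ℤ s, fun a => ?_, mk_span_int_lt hκ hs⟩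
  let K := (Submodule.span ℤ s).toAddSubgroup.topologicalClosure
  have hK : IsClosed (K : Set ℓ^1(S, ℝ)) := AddSubgroup.isClosed_topologicalClosure _
  have hmem (i : S) (r : ℝ) : r • unitVec i ∈ K := by
    refine Rat.denseRange_cast.induction_on (p := fun r : ℝ => r • unitVec i ∈ K) r
      (hK.preimage (f := fun r : ℝ => r • unitVec i) (by fun_prop)) fun q => ?_
    exact subset_closure (Submodule.subset_span ⟨(i, ⟨q⟩), rfl⟩)
  refine hK.mem_of_tendsto (lp.hasSum_single ENNReal.one_ne_top a)
    (Eventually.of_forall fun t => sum_mem fun i _ => ?_)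
  rw [single_eq_smul_unitVec]
  exact hmem i _

section Presentable

variable {E : Type u} [NormedAddCommGroup E] [NormedSpace ℝ E] [CompleteSpace E]

/-- A Banach space with a small dense subset is a quotient of a small `ℓ¹`-space. -/
theorem exists_ellOne_surjection {κ : Cardinal.{u}} (hκ : ℵ₀ < κ) {s : Set E} (hs : Dense s)
    (hsκ : #s < κ) : ∃ (S : Type u) (_ : #S < κ) (π : ℓ^1(S, ℝ) →L[ℝ] E),
      ∀ e, ∃ a, π a = e ∧ ‖a‖ ≤ 2 * ‖e‖ := by
  let D := (Submodule.span ℤ s).toAddSubgroup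
  -- For `d = 0` the convention `0⁻¹ = 0` makes this the zero vector.
  have hn (d : E) : ‖‖d‖⁻¹ • d‖ ≤ 1 := by
    rw [norm_smul, norm_inv, norm_norm]
    exact inv_mul_le_one
  obtain ⟨π, -, hπ⟩ := exists_ellOne_continuousLinearMap (S := D) (fun d => ‖(d : E)‖⁻¹ • (d : E))
    fun d => hn d
  refine ⟨D, mk_span_int_lt hκ hsκ, π, fun e => ?_⟩
  let p : NormedAddGroupHom ℓ^1(D, ℝ) E :=
    { toFun := π, map_add' := map_add π, bound' := ⟨‖π‖, π.le_opNorm⟩ }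
  have hp : p.SurjectiveOnWith D 1 := fun d hd => by
    refine ⟨‖d‖ • unitVec (⟨d, hd⟩ : D), ?_, ?_⟩
    · change π _ = d
      rw [map_smul, hπ]
      obtain rfl | h := eq_or_ne d 0
      · simp
      · exact smul_inv_smul₀ (norm_ne_zero_iff.mpr h) d
    · rw [norm_smul, norm_norm, norm_unitVec, mul_one, one_mul]
  -- Successive approximation extends solvability from the dense subgroup `D` to its closure, at the
  -- cost of raising the constant from 1 to `1 + 1`.
  have h := controlled_closure_of_complete one_pos one_pos hp
  have he : e ∈ D.topologicalClosure := closure_mono Submodule.subset_span (hs e)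
  obtain ⟨a, ha, hae⟩ := h e he
  exact ⟨a, ha, hae.trans_eq (by norm_num)⟩

/-- A lift of `p ≫ f` to a stage need not vanish on the kernel of `π`, but a dense subset `T` of
that kernel with `#T < κ` dies at a later stage, and with it the whole kernel. -/
theorem isCardinalPresentable_of_dense {κ : Cardinal.{u}} [Fact κ.IsRegular] (hκ : ℵ₀ < κ)
    {s : Set E} (hs : Dense s) (hsκ : #s < κ) : IsCardinalPresentable (ofBanach E) κ := by
  obtain ⟨S, hS, π, hπ⟩ := exists_ellOne_surjection hκ hs hsκ
  obtain ⟨Q, hQ, hQκ⟩ := exists_dense_ellOne hκ hS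
  obtain ⟨T, hT, hTκ, hTd⟩ := exists_subset_closure_of_dense hQ hκ hQκ
    (LinearMap.ker π.toLinearMap : Set ℓ^1(S, ℝ))
  let p : ellOne S ⟶ ofBanach E := ofBanachHom (X := ofBanach E) (E := ℓ^1(S, ℝ)) π.toLinearMap
    (π.lipschitz.isBounded_image Metric.isBounded_closedBall)
  refine isCardinalPresentable_of_exists_lift _ _ fun J _ _ F c hc => ?_
  have := isFiltered_of_isCardinalFiltered J κ
  have hF := hasSeparatedColimit_of_aleph0_lt F hκ
  refine ⟨fun f => ?_, fun j f g h => ?_⟩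
  · obtain ⟨j, g, hg⟩ := exists_ellOne_lift hF hc (p ≫ f)
    have hg' (a : ℓ^1(S, ℝ)) : lin (c.ι.app j) (ellLin g a) = banachLin f (π a) :=
      LinearMap.congr_fun (congrArg ellLin hg) a
    obtain ⟨k, a, ha⟩ := exists_common_map_eq_zero κ hTκ (fun t : T => ellLin g t) fun t =>
      exists_map_eq_zero_of_isColimit hF hc (by
        rw [hg', show π t = 0 from hT t.2, map_zero])
    let g' : ofBanach ℓ^1(S, ℝ) ⟶ F.obj k := g ≫ F.map a
    have hker (b : ℓ^1(S, ℝ)) (hb : π b = 0) : banachLin g' b = 0 :=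
      closure_minimal (t := (LinearMap.ker (banachLin g') : Set ℓ^1(S, ℝ)))
        (fun t ht => ha ⟨t, ht⟩) (isClosed_ker_banachLin g') (hTd hb)
    -- The choice `σ` of preimages is not linear, but `g'` depends only on the value of `π`, so `g'
    -- ∘ σ` is; the norm bound on `σ` makes it bounded.
    choose σ hσ hσn using hπ
    have heq (b b' : ℓ^1(S, ℝ)) (h : π b = π b') : banachLin g' b = banachLin g' b' := by
      rw [← sub_eq_zero, ← map_sub] at h ⊢
      exact hker _ h
    let Φ : E →ₗ[ℝ] F.obj k :=
      { toFun := fun e => banachLin g' (σ e)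
        map_add' := fun x y => by
          rw [← map_add]
          exact heq _ _ (by rw [map_add, hσ, hσ, hσ])
        map_smul' := fun r x => by
          rw [RingHom.id_apply, ← map_smul]
          exact heq _ _ (by rw [map_smul, hσ, hσ]) }
    refine ⟨k, ofBanachHom Φ ?_, hom_ext fun e => ?_⟩
    · refine (isBounded_image_banachLin g' (Metric.isBounded_closedBall (x := 0) (r := 2))).subset ?_
      rintro _ ⟨e, he, rfl⟩
      rw [mem_closedBall_zero_iff] at he
      refine ⟨σ e, ?_, rfl⟩
      rw [mem_closedBall_zero_iff]
      linarith [hσn e]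
    · have h1 := lin_congr (c.w a) (ellLin g (σ e))
      exact h1.trans ((hg' (σ e)).trans (congrArg (banachLin f) (hσ e)))
  · obtain ⟨k, a, ha⟩ := exists_map_eq_of_comp_eq hF hc hS (p ≫ f) (p ≫ g)
      (by rw [Category.assoc, Category.assoc, h])
    refine ⟨k, a, hom_ext fun e => ?_⟩
    obtain ⟨b, rfl, -⟩ := hπ e
    exact LinearMap.congr_fun (congrArg ellLin ha) b

theorem isCardinalPresentable_of_subsingleton [Subsingleton E] (κ : Cardinal.{u})
    [Fact κ.IsRegular] : IsCardinalPresentable (ofBanach E) κ := by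
  have hsub {X : CBorn.{u}} (f g : ofBanach E ⟶ X) : f = g := hom_ext fun e => by
    rw [show e = 0 from Subsingleton.elim (α := E) e 0, map_zero, map_zero]
  refine isCardinalPresentable_of_exists_lift _ _ fun J _ _ F c hc =>
    ⟨fun f => ?_, fun j f g _ => ⟨j, 𝟙 j, hsub _ _⟩⟩
  have := isFiltered_of_isCardinalFiltered J κ
  let j : J := Classical.choice IsFiltered.nonempty
  refine ⟨j, ofBanachHom 0 ((Bornology.isBounded_singleton (x := 0)).subset ?_), hsub _ _⟩
  rintro _ ⟨e, -, rfl⟩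
  rfl

theorem isCardinalPresentable_of_densityCharacter_lt {κ : Cardinal.{u}} [Fact κ.IsRegular]
    (h : densityCharacter E < κ) : IsCardinalPresentable (ofBanach E) κ := by
  obtain ⟨s, hs, hsκ⟩ := exists_dense_of_densityCharacter_lt h
  obtain hκ | rfl := (aleph0_le_of_isRegular κ).lt_or_eq
  · exact isCardinalPresentable_of_dense hκ hs hsκ
  -- A finite dense set is closed, hence everything, and a nonzero real vector space is infinite.
  · have hfin : s.Finite := lt_aleph0_iff_set_finite.mp hsκ
    have huniv : (Set.univ : Set E).Finite := by
      rwa [← hs.closure_eq, hfin.isClosed.closure_eq]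
    have : Subsingleton E := by
      by_contra hE
      rw [not_subsingleton_iff_nontrivial] at hE
      have := Module.Free.infinite ℝ E
      exact Set.infinite_univ huniv
    exact isCardinalPresentable_of_subsingleton _

end Presentable

end CBorn

theorem mainTheorem8 (κ : Cardinal.{u}) [Fact κ.IsRegular] :
    IsCardinalLocallyPresentable (CBornLT.{u} κ) κ ∧
      ∀ (E : Type u) [NormedAddCommGroup E] [NormedSpace ℝ E] [CompleteSpace E],
        densityCharacter E < κ → IsCardinalPresentable (CBorn.ofBanach E) κ := by
  exact ⟨CBorn.isCardinalLocallyPresentable_cbornLT,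
    fun _ _ _ _ => CBorn.isCardinalPresentable_of_densityCharacter_lt⟩
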